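/- Let $S=(S,\otimes,\mathbb 1)$ be a symmetric monoidal category. **The category $\mathcal E(S)$.** Its objects are pairs $(C,F)$ of a small category $C$ and a functor $F\colon C\to S$. A morphism $(C,F)\to(D,G)$ is a pair $(\Gamma,\gamma)$ of a functor $\Gamma\colon D\to C$ and a natural transformation $\gamma\colon F\Gamma\to G$; composition is $(\Lambda,\lambda)\circ(\Gamma,\gamma)=(\Gamma\Lambda,\{\lambda_Z\gamma_{\Lambda(Z)}\}_Z)$. It is symmetric monoidal with $(C,F)\boxtimes(D,G)=(C\times D,\ \otimes\circ(F\times G))$, unit the trivial category with value $\mathbb 1$, and constraints and symmetry induced from those of $\mathrm{Cat}$ and $S$. A Hopf algebra in a symmetric monoidal category is a bialgebra with an invertible antipode. **Crossed modules.** A crossed module $\xi\colon E\to H$ is a group homomorphism with a left action of $H$ on $E$ by group automorphisms such that $\xi({}^xe)=x\xi(e)x^{-1}$ and ${}^{\xi(e)}f=efe^{-1}$. Its groupoid $\mathcal G_\xi$ has object set $H$, $\mathrm{Hom}(x,y)=\{e\in E\mid y=\xi(e)x\}$, composition the product of $E$, and product functor $m_\xi\colon\mathcal G_\xi\times\mathcal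 G_\xi\to\mathcal G_\xi$ given by $(x,z)\mapsto xz$, $(x\xrightarrow{e}y,\ z\xrightarrow{f}t)\mapsto(xz\xrightarrow{e\,{}^xf}yt)$. **Hopf $\xi$-coalgebras.** A Hopf $\xi$-coalgebra in $S$ is a family $A=\{A_x\}_{x\in H}$ of algebras in $S$ with algebra morphisms $\Delta_{x,y}\colon A_{xy}\to A_x\otimes A_y$ and $\varepsilon\colon A_1\to\mathbb 1$, isomorphisms $S_x\colon A_{x^{-1}}\to A_x$ in $S$ and algebra isomorphisms $\phi_{x,e}\colon A_x\to A_{\xi(e)x}$, such that (associativity and unit constraints suppressed) for all $x,y,z\in H$, $e,f\in E$: $(\Delta_{x,y}\otimes\mathrm{id})\Delta_{xy,z}=(\mathrm{id}\otimes\Delta_{y,z})\Delta_{x,yz}$, $(\mathrm{id}\otimes\varepsilon)\Delta_{x,1}=\mathrm{id}=(\varepsilon\otimes\mathrm{id})\Delta_{1,x}$, $\mu_x(S_x\otimes\mathrm{id})\Delta_{x^{-1},x}=\eta_x\varepsilon=\mu_x(\mathrm{id}\otimes S_x)\Delta_{x,x^{-1}}$, $\phi_{x,1}=\mathrm{id}$,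 $\phi_{\xi(e)x,f}\,\phi_{x,e}=\phi_{x,fe}$, and $(\phi_{x,e}\otimes\phi_{y,f})\Delta_{x,y}=\Delta_{\xi(e)x,\xi(f)y}\,\phi_{xy,\,e\,{}^xf}$, where $\mu_x,\eta_x$ are the product and unit of $A_x$. An isomorphism $(\xi,A)\to(\xi',A')$ is an isomorphism $(\psi\colon E\to E',\varphi\colon H\to H')$ of crossed modules with algebra isomorphisms $A_x\to A'_{\varphi(x)}$ compatible with coproducts, counits and actions. **Theorem.** Assign to a pair $(\xi,A)$, where $\xi$ is a crossed module and $A$ is a Hopf $\xi$-coalgebra in $S$, the Hopf algebra $(\mathcal G_\xi,F_A)$ in $\mathcal E(S)$ with $F_A(x)=A_x$, $F_A(x\xrightarrow{e}\xi(e)x)=\phi_{x,e}$ and with product (diagonal functor, $\{\mu_x\}$), unit (augmentation functor, $\{\eta_x\}$), coproduct $(m_\xi,\{\Delta_{x,y}\})$, counit (functor with value $1\in H$, $\varepsilon$) and antipode (inversion functor $x\mapsto x^{-1}$, $(x\xrightarrow{e}y)\mapsto{}^{x^{-1}}(e^{-1})$; $\{S_x\}$). This gives a bijective correspondence between pairs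 $(\xi,A)$ and Hopf algebras in $\mathcal E(S)$, in the following sense. 1. Two pairs are isomorphic if and only if the associated Hopf algebras in $\mathcal E(S)$ are isomorphic. 2. Every Hopf algebra in $\mathcal E(S)$ is isomorphic to the Hopf algebra associated with some pair $(\xi,A)$. 3. For each crossed module $\xi$ the correspondence is bijective on the nose: for every functor $F\colon\mathcal G_\xi\to S$ and every Hopf algebra structure on $(\mathcal G_\xi,F)$ in $\mathcal E(S)$ whose coproduct has functor part $m_\xi$, there is exactly one Hopf $\xi$-coalgebra $A$ in $S$ whose associated Hopf algebra is equal to the given one. In particular this applies to the symmetric monoidal category $S=\mathrm{Mod}_k$ of modules over a commutative ring $k$. -/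

import Mathlib

open CategoryTheory MonoidalCategory

universe w v u

/-- Objects of the category `𝓔(S)`: pairs `(C, F)` of a small category `C` and a functor `F : C ⥤ S`. -/
structure ECat (S : Type u) [Category.{v} S] : Type (max (w + 1) u v) where
  C : Type w
  [cat : SmallCategory C]
  F : C ⥤ S

namespace ECat

attribute [instance] ECat.cat

section Cat

variable {S : Type u} [Category.{v} S]

/-- A morphism `(C, F) ⟶ (D, G)` in `𝓔(S)`: a functor `Γ : D ⥤ C` together with a natural
transformation `γ : F Γ ⟶ G`. -/
structure Hom (X Y : ECat.{w} S) where
  Γ : Y.C ⥤ X.C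
  γ : Γ ⋙ X.F ⟶ Y.F

/-- The identity is `(1_C, id_F)`; composition is `(Λ, λ) ∘ (Γ, γ) = (Γ Λ, λ_Z ∘ γ_{Λ(Z)})`. -/
instance : CategoryStruct (ECat.{w} S) where
  Hom := Hom
  id X := ⟨𝟭 X.C, { app := fun c => 𝟙 (X.F.obj c) }⟩
  comp {X Y Z} f g := ⟨g.Γ ⋙ f.Γ,
    { app := fun z => f.γ.app (g.Γ.obj z) ≫ g.γ.app z
      naturality := fun z z' h => by
        have h1 := f.γ.naturality (g.Γ.map h)
        have h2 := g.γ.naturality h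
        simp only [Functor.comp_map, Category.assoc] at h1 h2 ⊢
        rw [reassoc_of% h1, h2] }⟩

@[simp] lemma id_Γ (X : ECat.{w} S) : Hom.Γ (𝟙 X) = 𝟭 X.C := rfl
@[simp] lemma id_γ_app (X : ECat.{w} S) (c : X.C) : (Hom.γ (𝟙 X)).app c = 𝟙 (X.F.obj c) := rfl
@[simp] lemma comp_Γ {X Y Z : ECat.{w} S} (f : X ⟶ Y) (g : Y ⟶ Z) :
    Hom.Γ (f ≫ g) = Hom.Γ g ⋙ Hom.Γ f := rfl
@[simp] lemma comp_γ_app {X Y Z : ECat.{w} S} (f : X ⟶ Y) (g : Y ⟶ Z) (z : Z.C) :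
    (Hom.γ (f ≫ g)).app z = (Hom.γ f).app ((Hom.Γ g).obj z) ≫ (Hom.γ g).app z := rfl

/-- Two morphisms agree if their functors agree and their components agree (up to the
identification of their sources). -/
lemma hom_ext {X Y : ECat.{w} S} {f g : X ⟶ Y} (hΓ : Hom.Γ f = Hom.Γ g)
    (hγ : ∀ y : Y.C, (Hom.γ f).app y =
      eqToHom (congrArg (fun T : Y.C ⥤ X.C => X.F.obj (T.obj y)) hΓ) ≫ (Hom.γ g).app y) :
    f = g := by
  obtain ⟨Γ, γ⟩ := f
  obtain ⟨Γ', γ'⟩ := g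
  obtain rfl : Γ = Γ' := hΓ
  congr 1
  ext y
  simpa using hγ y

/-- The case of `hom_ext` where both functors are literally the same. -/
lemma hom_ext_same {X Y : ECat.{w} S} {Γ : Y.C ⥤ X.C} {γ γ' : Γ ⋙ X.F ⟶ Y.F}
    (h : ∀ y : Y.C, γ.app y = γ'.app y) : (Hom.mk Γ γ : X ⟶ Y) = Hom.mk Γ γ' := by
  congr 1
  ext y
  exact h y

instance : Category (ECat.{w} S) where
  id_comp f := hom_ext_same (fun y => by simp)
  comp_id f := hom_ext_same (fun y => by simp)
  assoc f g h := hom_ext_same (fun y => by simp)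

end Cat

section Monoidal

variable {S : Type u} [Category.{v} S] [MonoidalCategory S]

/-- `(C, F) ⊠ (D, G) = (C × D, F ⊗ G)`. -/
def tensor (X Y : ECat.{w} S) : ECat.{w} S :=
  ⟨X.C × Y.C, (X.F.prod Y.F) ⋙ MonoidalCategory.tensor S⟩

/-- The unit object: the trivial category with the functor with value the unit object. -/
def unit : ECat.{w} S := ⟨Discrete PUnit.{w + 1}, (Functor.const _).obj (𝟙_ S)⟩

/-- `(Γ, γ) ⊠ (Λ, λ) = (Γ × Λ, γ ⊗ λ)`. -/
def tensorMor {X X' Y Y' : ECat.{w} S} (f : X ⟶ X') (g : Y ⟶ Y') : tensor X Y ⟶ tensor X' Y' :=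
  ⟨(Hom.Γ f).prod (Hom.Γ g),
    { app := fun p => (Hom.γ f).app p.1 ⊗ₘ (Hom.γ g).app p.2
      naturality := fun p q h => by
        have h1 := (Hom.γ f).naturality h.1
        have h2 := (Hom.γ g).naturality h.2
        exact (tensorHom_comp_tensorHom _ _ _ _).trans
          ((congrArg₂ (fun a b => a ⊗ₘ b) h1 h2).trans (tensorHom_comp_tensorHom _ _ _ _).symm) }⟩

/-- The associativity constraint, induced by those of `Cat` and `S`. -/
def assoc (X Y Z : ECat.{w} S) : tensor (tensor X Y) Z ≅ tensor X (tensor Y Z) where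
  hom := ⟨prod.inverseAssociator X.C Y.C Z.C,
    { app := fun p => (α_ (X.F.obj p.1) (Y.F.obj p.2.1) (Z.F.obj p.2.2)).hom
      naturality := fun _ _ h =>
        associator_naturality (X.F.map h.1) (Y.F.map h.2.1) (Z.F.map h.2.2) }⟩
  inv := ⟨prod.associator X.C Y.C Z.C,
    { app := fun p => (α_ (X.F.obj p.1.1) (Y.F.obj p.1.2) (Z.F.obj p.2)).inv
      naturality := fun _ _ h =>
        associator_inv_naturality (X.F.map h.1.1) (Y.F.map h.1.2) (Z.F.map h.2) }⟩
  hom_inv_id := hom_ext_same (fun y =>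
    (α_ (X.F.obj y.1.1) (Y.F.obj y.1.2) (Z.F.obj y.2)).hom_inv_id)
  inv_hom_id := hom_ext_same (fun y =>
    (α_ (X.F.obj y.1) (Y.F.obj y.2.1) (Z.F.obj y.2.2)).inv_hom_id)

/-- The left unitality constraint, induced by those of `Cat` and `S`. -/
def leftUnit (X : ECat.{w} S) : tensor unit X ≅ X where
  hom := ⟨Functor.prod' ((Functor.const _).obj ⟨PUnit.unit⟩) (𝟭 X.C),
    { app := fun p => (λ_ (X.F.obj p)).hom
      naturality := fun _ q h =>
        (congrArg (· ≫ (λ_ (X.F.obj q)).hom) (id_tensorHom _ _)).trans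
          (leftUnitor_naturality (X.F.map h)) }⟩
  inv := ⟨CategoryTheory.Prod.snd _ X.C,
    { app := fun p => (λ_ (X.F.obj p.2)).inv
      naturality := fun p _ h =>
        (leftUnitor_inv_naturality (X.F.map h.2)).trans
          (congrArg ((λ_ (X.F.obj p.2)).inv ≫ ·) (id_tensorHom _ _).symm) }⟩
  hom_inv_id := hom_ext_same (fun y => (λ_ (X.F.obj y.2)).hom_inv_id)
  inv_hom_id := hom_ext_same (fun y => (λ_ (X.F.obj y)).inv_hom_id)

/-- The right unitality constraint, induced by those of `Cat` and `S`. -/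
def rightUnit (X : ECat.{w} S) : tensor X unit ≅ X where
  hom := ⟨Functor.prod' (𝟭 X.C) ((Functor.const _).obj ⟨PUnit.unit⟩),
    { app := fun p => (ρ_ (X.F.obj p)).hom
      naturality := fun _ q h =>
        (congrArg (· ≫ (ρ_ (X.F.obj q)).hom) (tensorHom_id _ _)).trans
          (rightUnitor_naturality (X.F.map h)) }⟩
  inv := ⟨CategoryTheory.Prod.fst X.C _,
    { app := fun p => (ρ_ (X.F.obj p.1)).inv
      naturality := fun p _ h =>
        (rightUnitor_inv_naturality (X.F.map h.1)).trans
          (congrArg ((ρ_ (X.F.obj p.1)).inv ≫ ·) (tensorHom_id _ _).symm) }⟩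
  hom_inv_id := hom_ext_same (fun y => (ρ_ (X.F.obj y.1)).hom_inv_id)
  inv_hom_id := hom_ext_same (fun y => (ρ_ (X.F.obj y)).inv_hom_id)

instance : MonoidalCategory (ECat.{w} S) where
  tensorObj := tensor
  tensorHom := tensorMor
  whiskerLeft X _ _ f := tensorMor (𝟙 X) f
  whiskerRight f Y := tensorMor f (𝟙 Y)
  tensorUnit := unit
  associator := assoc
  leftUnitor := leftUnit
  rightUnitor := rightUnit
  tensorHom_def f g := hom_ext_same (fun y =>
    (by simp [MonoidalCategory.tensorHom_def] : ∀ {a b c d : S} (p : a ⟶ b) (q : c ⟶ d),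
      p ⊗ₘ q = (p ⊗ₘ 𝟙 c) ≫ (𝟙 b ⊗ₘ q)) _ _)
  id_tensorHom_id X Y := hom_ext_same (fun y => id_tensorHom_id _ _)
  tensorHom_comp_tensorHom f g h k := hom_ext_same (fun y => tensorHom_comp_tensorHom _ _ _ _)
  whiskerLeft_id X Y := hom_ext_same (fun y => id_tensorHom_id _ _)
  id_whiskerRight X Y := hom_ext_same (fun y => id_tensorHom_id _ _)
  associator_naturality f g h := hom_ext_same (fun y => associator_naturality _ _ _)
  leftUnitor_naturality {X Y} f := hom_ext_same (fun y => by
    exact (congrArg (· ≫ (λ_ (Y.F.obj y)).hom) (id_tensorHom _ _)).trans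
      (leftUnitor_naturality (f.γ.app y)))
  rightUnitor_naturality {X Y} f := hom_ext_same (fun y => by
    exact (congrArg (· ≫ (ρ_ (Y.F.obj y)).hom) (tensorHom_id _ _)).trans
      (rightUnitor_naturality (f.γ.app y)))
  pentagon W X Y Z := hom_ext_same (fun _ =>
    (by simp : ∀ a b c d : S, ((α_ a b c).hom ⊗ₘ 𝟙 d) ≫ (α_ a (b ⊗ c) d).hom ≫
      (𝟙 a ⊗ₘ (α_ b c d).hom) = (α_ (a ⊗ b) c d).hom ≫ (α_ a b (c ⊗ d)).hom) _ _ _ _)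
  triangle X Y := hom_ext rfl (fun _ => Eq.trans
    ((by simp : ∀ a b : S, (α_ a (𝟙_ S) b).hom ≫ (𝟙 a ⊗ₘ (λ_ b).hom) =
      (ρ_ a).hom ⊗ₘ 𝟙 b) _ _) (Category.id_comp _).symm)

end Monoidal

section Symmetric

variable {S : Type u} [Category.{v} S] [MonoidalCategory S] [SymmetricCategory S]

/-- The symmetry, induced by those of `Cat` and `S`. -/
def braid (X Y : ECat.{w} S) : tensor X Y ≅ tensor Y X where
  hom := ⟨CategoryTheory.Prod.swap Y.C X.C,
    { app := fun p => (β_ (X.F.obj p.2) (Y.F.obj p.1)).hom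
      naturality := fun _ _ h => BraidedCategory.braiding_naturality (X.F.map h.2) (Y.F.map h.1) }⟩
  inv := ⟨CategoryTheory.Prod.swap X.C Y.C,
    { app := fun p => (β_ (X.F.obj p.1) (Y.F.obj p.2)).inv
      naturality := fun _ _ h =>
        BraidedCategory.braiding_inv_naturality (Y.F.map h.2) (X.F.map h.1) }⟩
  hom_inv_id := hom_ext_same (fun y => (β_ (X.F.obj y.1) (Y.F.obj y.2)).hom_inv_id)
  inv_hom_id := hom_ext_same (fun y => (β_ (X.F.obj y.2) (Y.F.obj y.1)).inv_hom_id)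

instance : BraidedCategory (ECat.{w} S) where
  braiding := braid
  braiding_naturality_right _ _ _ _ := hom_ext_same (fun _ =>
    BraidedCategory.braiding_naturality _ _)
  braiding_naturality_left _ _ := hom_ext_same (fun _ =>
    BraidedCategory.braiding_naturality _ _)
  hexagon_forward _ _ _ := hom_ext_same (fun _ =>
    (by simp : ∀ a b c : S, (α_ a b c).hom ≫ (β_ a (b ⊗ c)).hom ≫ (α_ b c a).hom =
      ((β_ a b).hom ⊗ₘ 𝟙 c) ≫ (α_ b a c).hom ≫ (𝟙 b ⊗ₘ (β_ a c).hom)) _ _ _)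
  hexagon_reverse _ _ _ := hom_ext_same (fun _ =>
    (by simp : ∀ a b c : S, (α_ a b c).inv ≫ (β_ (a ⊗ b) c).hom ≫ (α_ c a b).inv =
      (𝟙 a ⊗ₘ (β_ b c).hom) ≫ (α_ a c b).inv ≫ ((β_ a c).hom ⊗ₘ 𝟙 b)) _ _ _)

instance : SymmetricCategory (ECat.{w} S) where
  symmetry _ _ := hom_ext_same (fun _ => SymmetricCategory.symmetry _ _)

/-- The exchange of the middle factors in `𝓔(S)` is computed by that of `S`. -/
lemma tensorμ_app (W X Y Z : ECat.{w} S) (p : W.C) (q : X.C) (r : Y.C) (s : Z.C) :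
    (Hom.γ (tensorμ W X Y Z)).app (((p, r), (q, s)) : (W.C × Y.C) × (X.C × Z.C)) =
      tensorμ (W.F.obj p) (X.F.obj q) (Y.F.obj r) (Z.F.obj s) :=
  (by simp [tensorμ] : ∀ a b c d : S,
    (α_ a b (c ⊗ d)).hom ≫ (𝟙 a ⊗ₘ (α_ b c d).inv) ≫ (𝟙 a ⊗ₘ ((β_ b c).hom ⊗ₘ 𝟙 d)) ≫
      (𝟙 a ⊗ₘ (α_ c b d).hom) ≫ (α_ a c (b ⊗ d)).inv = tensorμ a b c d) _ _ _ _

end Symmetric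
end ECat

/-- A crossed module `∂ : E → H`: a group homomorphism with an action of `H` on `E` by group
automorphisms such that `∂` is equivariant and the Peiffer identity holds. -/
structure CrossedModule : Type (w + 1) where
  E : Type w
  H : Type w
  [groupE : Group E]
  [groupH : Group H]
  [action : MulDistribMulAction H E]
  bd : E →* H
  equivariant : ∀ (x : H) (e : E), bd (x • e) = x * bd e * x⁻¹
  peiffer : ∀ e f : E, bd e • f = e * f * e⁻¹

namespace CrossedModule

attribute [instance] groupE groupH action

variable (ξ : CrossedModule.{w})

/-- The objects of the groupoid associated with a crossed module are the elements of `H`. -/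
structure Gpd : Type w where
  of ::
  val : ξ.H

variable {ξ}

lemma comp_aux {x y z : ξ.H} {e f : ξ.E} (h : y = ξ.bd e * x) (h' : z = ξ.bd f * y) :
    z = ξ.bd (f * e) * x := by
  rw [h', h, map_mul, mul_assoc]

lemma mul_aux {x y x' y' : ξ.H} {e f : ξ.E} (h : x' = ξ.bd e * x) (h' : y' = ξ.bd f * y) :
    x' * y' = ξ.bd (e * x • f) * (x * y) := by
  rw [h, h', map_mul, ξ.equivariant]; group

lemma mul_aux_comp {x x' : ξ.H} {e e' f f' : ξ.E} (h : x' = ξ.bd e * x) :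
    e' * e * (x • (f' * f)) = e' * (x' • f') * (e * x • f) := by
  rw [h, mul_smul, ξ.peiffer, smul_mul']; group

lemma inv_aux {x y : ξ.H} {e : ξ.E} (h : y = ξ.bd e * x) :
    y⁻¹ = ξ.bd (x⁻¹ • e⁻¹) * x⁻¹ := by
  rw [h, ξ.equivariant, map_inv]; group

lemma inv_aux_comp {x y : ξ.H} {e f : ξ.E} (h : y = ξ.bd e * x) :
    x⁻¹ • (f * e)⁻¹ = y⁻¹ • f⁻¹ * x⁻¹ • e⁻¹ := by
  rw [h, mul_inv_rev, mul_inv_rev, mul_smul, ← map_inv, ξ.peiffer, ← smul_mul']; group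

/-- `Hom(x, y) = {e ∈ E | y = ∂(e) x}`, with composition the product of `E`. -/
instance : SmallCategory ξ.Gpd where
  Hom x y := {e : ξ.E // y.val = ξ.bd e * x.val}
  id x := ⟨1, by simp⟩
  comp {x y z} e f := ⟨f.1 * e.1, comp_aux e.2 f.2⟩
  id_comp f := Subtype.ext (_root_.mul_one _)
  comp_id f := Subtype.ext (_root_.one_mul _)
  assoc f g h := Subtype.ext (_root_.mul_assoc _ _ _).symm

namespace Gpd

@[simp] lemma id_val (x : ξ.Gpd) : Subtype.val (𝟙 x : x ⟶ x) = 1 := rfl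
@[simp] lemma comp_val {x y z : ξ.Gpd} (f : x ⟶ y) (g : y ⟶ z) :
    Subtype.val (f ≫ g) = g.1 * f.1 := rfl

lemma eqToHom_val {x y : ξ.Gpd} (h : x = y) : Subtype.val (eqToHom h) = 1 := by
  subst h; rfl

/-- Functors into the groupoid of a crossed module agree if they agree on objects and on the
elements of `E` labelling the morphisms. -/
lemma functor_ext {D : Type*} [Category D] {P Q : D ⥤ ξ.Gpd}
    (h₁ : ∀ d, (P.obj d).val = (Q.obj d).val)
    (h₂ : ∀ {d d' : D} (f : d ⟶ d'), Subtype.val (P.map f) = Subtype.val (Q.map f)) : P = Q := by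
  have h : ∀ d, P.obj d = Q.obj d := fun d => congrArg Gpd.of (h₁ d)
  refine CategoryTheory.Functor.ext h (fun d d' f => Subtype.ext ?_)
  simp [eqToHom_val, h₂]

end Gpd

variable (ξ)

/-- The product functor of the groupoid of a crossed module:
`(x, z) ↦ x z` and `(e : x → y, f : z → t) ↦ e (x • f)`. -/
def mulFunctor : ξ.Gpd × ξ.Gpd ⥤ ξ.Gpd where
  obj p := ⟨p.1.val * p.2.val⟩
  map {p q} f := ⟨f.1.1 * p.1.val • f.2.1, mul_aux f.1.2 f.2.2⟩
  map_id p := Subtype.ext (by simp)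
  map_comp {p q r} f g := Subtype.ext (mul_aux_comp f.1.2)

/-- The unit functor of the groupoid of a crossed module, with value `1 ∈ H`. -/
def unitFunctor : Discrete PUnit.{w + 1} ⥤ ξ.Gpd := (Functor.const _).obj ⟨1⟩

/-- The inversion functor of the groupoid of a crossed module:
`x ↦ x⁻¹` and `(e : x → y) ↦ x⁻¹ • e⁻¹`. -/
def invFunctor : ξ.Gpd ⥤ ξ.Gpd where
  obj x := ⟨x.val⁻¹⟩
  map {x y} f := ⟨x.val⁻¹ • f.1⁻¹, inv_aux f.2⟩
  map_id x := Subtype.ext (by simp)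
  map_comp {x y z} f g := Subtype.ext (inv_aux_comp f.2)

end CrossedModule

section HopfCoalg

variable {S : Type u} [Category.{v} S] [MonoidalCategory S] [SymmetricCategory S]

open scoped MonObj ComonObj

variable (S) in
/-- A Hopf `ξ`-coalgebra in `S`. Algebras in `S` and algebra morphisms are the objects and
morphisms of `Mon S`; the maps `eqToHom _` are the identifications of `A_x` and `A_y` when
`x = y` in `H`. -/
structure HopfCoalg (ξ : CrossedModule.{w}) : Type (max w u v) where
  A : ξ.H → Mon S
  /-- the coproduct -/
  cop (x y : ξ.H) : A (x * y) ⟶ A x ⊗ A y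
  /-- the counit -/
  cou : A 1 ⟶ 𝟙_ (Mon S)
  /-- the antipode -/
  anti (x : ξ.H) : (A x⁻¹).X ≅ (A x).X
  /-- the crossed module action -/
  act (x : ξ.H) (e : ξ.E) : A x ≅ A (ξ.bd e * x)
  coassoc (x y z : ξ.H) :
    cop (x * y) z ≫ cop x y ▷ A z ≫ (α_ (A x) (A y) (A z)).hom =
      eqToHom (congrArg A (mul_assoc x y z)) ≫ cop x (y * z) ≫ A x ◁ cop y z
  counit_left (x : ξ.H) :
    cop 1 x ≫ cou ▷ A x ≫ (λ_ (A x)).hom = eqToHom (congrArg A (one_mul x))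
  counit_right (x : ξ.H) :
    cop x 1 ≫ A x ◁ cou ≫ (ρ_ (A x)).hom = eqToHom (congrArg A (mul_one x))
  anti_left (x : ξ.H) :
    (cop x⁻¹ x).hom ≫ (anti x).hom ▷ (A x).X ≫ μ[(A x).X] =
      (eqToHom (congrArg A (inv_mul_cancel x))).hom ≫ cou.hom ≫ η[(A x).X]
  anti_right (x : ξ.H) :
    (cop x x⁻¹).hom ≫ (A x).X ◁ (anti x).hom ≫ μ[(A x).X] =
      (eqToHom (congrArg A (mul_inv_cancel x))).hom ≫ cou.hom ≫ η[(A x).X]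
  act_one (x : ξ.H) :
    (act x 1).hom = eqToHom (congrArg A (by rw [map_one, one_mul]))
  act_mul (x : ξ.H) (e f : ξ.E) :
    (act x e).hom ≫ (act (ξ.bd e * x) f).hom =
      (act x (f * e)).hom ≫ eqToHom (congrArg A (by rw [map_mul, mul_assoc]))
  act_cop (x y : ξ.H) (e f : ξ.E) :
    cop x y ≫ ((act x e).hom ⊗ₘ (act y f).hom) =
      (act (x * y) (e * x • f)).hom ≫
        eqToHom (congrArg A (CrossedModule.mul_aux rfl rfl).symm) ≫
          cop (ξ.bd e * x) (ξ.bd f * y)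

variable (S) in
/-- A pair `(ξ, A)` of a crossed module `ξ` and a Hopf `ξ`-coalgebra `A` in `S`. -/
structure HopfPair : Type (max (w + 1) u v) where
  ξ : CrossedModule.{w}
  coalg : HopfCoalg S ξ

/-- An isomorphism of pairs: an isomorphism `(ψ, φ)` of crossed modules and a family of
isomorphisms of algebras `A_x ≅ B_{φ(x)}` compatible with coproducts, counits and actions
(the compatibility with antipodes is then automatic). -/
structure HopfPair.Iso (P Q : HopfPair.{w} S) where
  ψ : P.ξ.E ≃* Q.ξ.E
  φ : P.ξ.H ≃* Q.ξ.H
  bd_comm (e : P.ξ.E) : Q.ξ.bd (ψ e) = φ (P.ξ.bd e)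
  smul_comm (x : P.ξ.H) (e : P.ξ.E) : ψ (x • e) = φ x • ψ e
  f (x : P.ξ.H) : P.coalg.A x ≅ Q.coalg.A (φ x)
  cop_comm (x y : P.ξ.H) :
    P.coalg.cop x y ≫ ((f x).hom ⊗ₘ (f y).hom) =
      (f (x * y)).hom ≫ eqToHom (congrArg Q.coalg.A (map_mul φ x y)) ≫
        Q.coalg.cop (φ x) (φ y)
  cou_comm : P.coalg.cou =
    (f 1).hom ≫ eqToHom (congrArg Q.coalg.A (map_one φ)) ≫ Q.coalg.cou
  act_comm (x : P.ξ.H) (e : P.ξ.E) :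
    (P.coalg.act x e).hom ≫ (f (P.ξ.bd e * x)).hom =
      (f x).hom ≫ (Q.coalg.act (φ x) (ψ e)).hom ≫
        eqToHom (congrArg Q.coalg.A (by rw [map_mul, bd_comm]))

namespace HopfCoalg

variable {ξ : CrossedModule.{w}} (A : HopfCoalg S ξ)

/-- The identification `A_x = A_y` when `x = y`. -/
def tr {x y : ξ.H} (h : x = y) : A.A x ⟶ A.A y := eqToHom (congrArg A.A h)

/-- The action of a morphism `e : x → y` of the groupoid of `ξ`. -/
def ac {x y : ξ.H} (e : ξ.E) (h : y = ξ.bd e * x) : A.A x ⟶ A.A y :=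
  (A.act x e).hom ≫ A.tr h.symm

lemma tr_hom {x y : ξ.H} (h : x = y) :
    (A.tr h).hom = eqToHom (congrArg (fun x => (A.A x).X) h) := by
  subst h; rfl

lemma ac_one {x y : ξ.H} (h : y = ξ.bd 1 * x) : A.ac 1 h = A.tr (by simp [h]) := by
  simp [ac, tr, A.act_one]

lemma ac_eq {x y : ξ.H} {e f : ξ.E} (h : y = ξ.bd e * x) (hef : e = f) :
    A.ac e h = A.ac f (hef ▸ h) := by
  subst hef; rfl

lemma ac_mul {x y z : ξ.H} {e f : ξ.E} (h : y = ξ.bd e * x) (h' : z = ξ.bd f * y) :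
    A.ac e h ≫ A.ac f h' = A.ac (f * e) (by rw [h', h, map_mul, mul_assoc]) := by
  subst h
  subst h'
  have := A.act_mul x e f
  simp [ac, tr, this]

lemma ac_cop {x y x' y' : ξ.H} {e f : ξ.E} (h : x' = ξ.bd e * x) (h' : y' = ξ.bd f * y) :
    A.cop x y ≫ (A.ac e h ⊗ₘ A.ac f h') =
      A.ac (e * x • f) (CrossedModule.mul_aux h h') ≫ A.cop x' y' := by
  subst h
  subst h'
  have := A.act_cop x y e f
  simp only [ac, tr, eqToHom_refl, Category.comp_id, Category.assoc, this]

/-- The functor `x ↦ A_x`, `(e : x → y) ↦ φ_{x,e}`. -/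
def functor : ξ.Gpd ⥤ S where
  obj x := (A.A x.val).X
  map {x y} e := (A.ac e.1 e.2).hom
  map_id x := by
    change (A.ac 1 _).hom = _
    rw [A.ac_one]; rfl
  map_comp {x y z} e f := by
    rw [← Mon.comp_hom', A.ac_mul]; rfl

/-- The object of `𝓔(S)` associated with a Hopf `ξ`-coalgebra. -/
def obj : ECat.{w} S := ⟨ξ.Gpd, A.functor⟩

/-- Axioms of a Hopf `ξ`-coalgebra, as equations in `S`. -/
lemma coassoc_hom (x y z : ξ.H) :
    (A.cop x (y * z)).hom ≫ (𝟙 (A.A x).X ⊗ₘ (A.cop y z).hom) =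
      eqToHom (congrArg (fun x => (A.A x).X) (mul_assoc x y z).symm) ≫ (A.cop (x * y) z).hom ≫
        ((A.cop x y).hom ⊗ₘ 𝟙 (A.A z).X) ≫ (α_ (A.A x).X (A.A y).X (A.A z).X).hom := by
  have h := congrArg Mon.Hom.hom (A.coassoc x y z)
  have h' := A.tr_hom (mul_assoc x y z)
  rw [tr] at h'
  simp only [Mon.comp_hom', Mon.whiskerLeft_hom, Mon.whiskerRight_hom,
    Mon.associator_hom_hom, h'] at h
  rw [tensorHom_id, id_tensorHom, h]
  simp

lemma counit_left_hom (x : ξ.H) :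
    (A.cop 1 x).hom ≫ (A.cou.hom ⊗ₘ 𝟙 (A.A x).X) =
      eqToHom (congrArg (fun x => (A.A x).X) (one_mul x)) ≫ (λ_ (A.A x).X).inv := by
  have h := congrArg Mon.Hom.hom (A.counit_left x)
  have h' := A.tr_hom (one_mul x)
  rw [tr] at h'
  simp only [Mon.comp_hom', Mon.leftUnitor_hom_hom, h'] at h
  rw [tensorHom_id, ← h]
  simp

lemma counit_right_hom (x : ξ.H) :
    (A.cop x 1).hom ≫ (𝟙 (A.A x).X ⊗ₘ A.cou.hom) =
      eqToHom (congrArg (fun x => (A.A x).X) (mul_one x)) ≫ (ρ_ (A.A x).X).inv := by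
  have h := congrArg Mon.Hom.hom (A.counit_right x)
  have h' := A.tr_hom (mul_one x)
  rw [tr] at h'
  simp only [Mon.comp_hom', Mon.rightUnitor_hom_hom, h'] at h
  rw [id_tensorHom, ← h]
  simp

lemma anti_left_hom (x : ξ.H) :
    (A.cop x⁻¹ x).hom ≫ ((A.anti x).hom ⊗ₘ 𝟙 (A.A x).X) ≫ μ[(A.A x).X] =
      eqToHom (congrArg (fun x => (A.A x).X) (inv_mul_cancel x)) ≫ A.cou.hom ≫ η[(A.A x).X] := by
  rw [tensorHom_id, A.anti_left x]
  exact congrArg (· ≫ A.cou.hom ≫ η[(A.A x).X]) (A.tr_hom (inv_mul_cancel x))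

lemma anti_right_hom (x : ξ.H) :
    (A.cop x x⁻¹).hom ≫ (𝟙 (A.A x).X ⊗ₘ (A.anti x).hom) ≫ μ[(A.A x).X] =
      eqToHom (congrArg (fun x => (A.A x).X) (mul_inv_cancel x)) ≫ A.cou.hom ≫ η[(A.A x).X] := by
  rw [id_tensorHom, A.anti_right x]
  exact congrArg (· ≫ A.cou.hom ≫ η[(A.A x).X]) (A.tr_hom (mul_inv_cancel x))

/-- The convolution product of `p : A_x ⟶ B` and `q : A_y ⟶ B`. -/
def conv {B : S} [MonObj B] {x y : ξ.H} (p : (A.A x).X ⟶ B) (q : (A.A y).X ⟶ B) :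
    (A.A (x * y)).X ⟶ B :=
  (A.cop x y).hom ≫ (p ⊗ₘ q) ≫ μ[B]

lemma conv_assoc {B : S} [MonObj B] {x y z : ξ.H} (p : (A.A x).X ⟶ B) (q : (A.A y).X ⟶ B)
    (r : (A.A z).X ⟶ B) :
    A.conv p (A.conv q r) =
      eqToHom (congrArg (fun x => (A.A x).X) (mul_assoc x y z).symm) ≫ A.conv (A.conv p q) r := by
  have h1 : A.conv p (A.conv q r) =
      ((A.cop x (y * z)).hom ≫ (𝟙 (A.A x).X ⊗ₘ (A.cop y z).hom)) ≫ (p ⊗ₘ (q ⊗ₘ r)) ≫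
        (B ◁ μ[B]) ≫ μ[B] := by
    simp [conv, ← id_tensorHom]
  have h2 : A.conv (A.conv p q) r =
      (A.cop (x * y) z).hom ≫ ((A.cop x y).hom ⊗ₘ 𝟙 (A.A z).X) ≫ ((p ⊗ₘ q) ⊗ₘ r) ≫
        (μ[B] ▷ B) ≫ μ[B] := by
    simp only [conv, ← tensorHom_id, tensorHom_comp_tensorHom_assoc, Category.id_comp,
      Category.comp_id]
  rw [h1, h2, A.coassoc_hom, MonObj.mul_assoc]
  simp only [Category.assoc, associator_naturality_assoc]

lemma unit_conv {B : S} [MonObj B] {x y : ξ.H} (h : y = 1) (q : (A.A x).X ⟶ B) :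
    A.conv (eqToHom (congrArg (fun x => (A.A x).X) h) ≫ A.cou.hom ≫ η[B]) q =
      eqToHom (congrArg (fun x => (A.A x).X) (by rw [h, one_mul])) ≫ q := by
  subst h
  have h1 : A.conv (A.cou.hom ≫ η[B]) q =
      ((A.cop 1 x).hom ≫ (A.cou.hom ⊗ₘ 𝟙 (A.A x).X)) ≫ (η[B] ⊗ₘ q) ≫ μ[B] := by
    simp only [conv, Category.assoc, tensorHom_comp_tensorHom_assoc, Category.id_comp]
  simp only [eqToHom_refl, Category.id_comp]
  rw [h1, A.counit_left_hom, MonObj.one_mul_hom]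
  simp

lemma conv_unit {B : S} [MonObj B] {x y : ξ.H} (h : y = 1) (q : (A.A x).X ⟶ B) :
    A.conv q (eqToHom (congrArg (fun x => (A.A x).X) h) ≫ A.cou.hom ≫ η[B]) =
      eqToHom (congrArg (fun x => (A.A x).X) (by rw [h, mul_one])) ≫ q := by
  subst h
  have h1 : A.conv q (A.cou.hom ≫ η[B]) =
      ((A.cop x 1).hom ≫ (𝟙 (A.A x).X ⊗ₘ A.cou.hom)) ≫ (q ⊗ₘ η[B]) ≫ μ[B] := by
    simp only [conv, Category.assoc, tensorHom_comp_tensorHom_assoc, Category.id_comp]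
  simp only [eqToHom_refl, Category.id_comp]
  rw [h1, A.counit_right_hom, MonObj.mul_one_hom]
  simp

/-- Naturality of the antipode with respect to the action. -/
lemma anti_natural {x y : ξ.H} {e : ξ.E} (h : y = ξ.bd e * x) :
    (A.ac (x⁻¹ • e⁻¹) (CrossedModule.inv_aux h)).hom ≫ (A.anti y).hom =
      (A.anti x).hom ≫ (A.ac e h).hom := by
  have h1 : A.conv ((A.anti x).hom ≫ (A.ac e h).hom) (A.ac e h).hom =
      eqToHom (congrArg (fun x => (A.A x).X) (inv_mul_cancel x)) ≫
        A.cou.hom ≫ η[(A.A y).X] := by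
    rw [← IsMonHom.one_hom (A.ac e h).hom, ← Category.assoc A.cou.hom, ← Category.assoc (eqToHom _),
      ← A.anti_left_hom x]
    simp only [conv, Category.assoc, IsMonHom.mul_hom, tensorHom_comp_tensorHom_assoc,
      Category.id_comp]
  have h2 : A.conv (A.ac e h).hom
      ((A.ac (x⁻¹ • e⁻¹) (CrossedModule.inv_aux h)).hom ≫ (A.anti y).hom) =
      eqToHom (congrArg (fun x => (A.A x).X) (mul_inv_cancel x)) ≫
        A.cou.hom ≫ η[(A.A y).X] := by
    have h3 := congrArg Mon.Hom.hom (A.ac_cop h (CrossedModule.inv_aux h))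
    rw [A.ac_eq (f := 1) _ (show e * x • x⁻¹ • e⁻¹ = 1 by rw [smul_inv_smul, mul_inv_cancel]), A.ac_one,
      Mon.comp_hom', Mon.comp_hom', tr_hom] at h3
    change (A.cop x x⁻¹).hom ≫ ((A.ac e h).hom ⊗ₘ
      (A.ac (x⁻¹ • e⁻¹) (CrossedModule.inv_aux h)).hom) = _ at h3
    have h4 : A.conv (A.ac e h).hom
        ((A.ac (x⁻¹ • e⁻¹) (CrossedModule.inv_aux h)).hom ≫ (A.anti y).hom) =
        ((A.cop x x⁻¹).hom ≫ ((A.ac e h).hom ⊗ₘ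
          (A.ac (x⁻¹ • e⁻¹) (CrossedModule.inv_aux h)).hom)) ≫
          (𝟙 (A.A y).X ⊗ₘ (A.anti y).hom) ≫ μ[(A.A y).X] := by
      simp only [conv, Category.assoc, tensorHom_comp_tensorHom_assoc, Category.comp_id]
    rw [h4, h3, Category.assoc, A.anti_right_hom]
    simp
  have h5 := A.conv_assoc ((A.anti x).hom ≫ (A.ac e h).hom) (A.ac e h).hom
    ((A.ac (x⁻¹ • e⁻¹) (CrossedModule.inv_aux h)).hom ≫ (A.anti y).hom)
  rw [h1, h2, A.unit_conv (inv_mul_cancel x), A.conv_unit (mul_inv_cancel x),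
    eqToHom_trans_assoc] at h5
  exact ((cancel_epi _).1 h5).symm

/-- The product: the diagonal functor with the products of the algebras `A_x`. -/
def mulMor : A.obj ⊗ A.obj ⟶ A.obj :=
  ⟨Functor.diag ξ.Gpd,
    { app := fun x => μ[(A.A x.val).X]
      naturality := fun _ _ e => (IsMonHom.mul_hom (A.ac e.1 e.2).hom).symm }⟩

/-- The unit: the functor to the trivial category with the units of the algebras `A_x`. -/
def oneMor : 𝟙_ (ECat.{w} S) ⟶ A.obj :=
  ⟨(Functor.const _).obj ⟨PUnit.unit⟩,
    { app := fun x => η[(A.A x.val).X]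
      naturality := fun _ _ e =>
        (Category.id_comp _).trans (IsMonHom.one_hom (A.ac e.1 e.2).hom).symm }⟩

/-- The coproduct: the product functor of the groupoid with the coproducts of `A`. -/
def comulMor : A.obj ⟶ A.obj ⊗ A.obj :=
  ⟨ξ.mulFunctor,
    { app := fun p => (A.cop p.1.val p.2.val).hom
      naturality := fun _ _ e => (congrArg Mon.Hom.hom (A.ac_cop e.1.2 e.2.2)).symm }⟩

/-- The counit: the unit functor of the groupoid with the counit of `A`. -/
def counitMor : A.obj ⟶ 𝟙_ (ECat.{w} S) :=
  ⟨ξ.unitFunctor,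
    { app := fun _ => A.cou.hom
      naturality := fun p _ _ =>
        (congrArg (· ≫ A.cou.hom) (A.functor.map_id (ξ.unitFunctor.obj p))).trans
          ((Category.id_comp _).trans (Category.comp_id _).symm) }⟩

/-- The antipode: the inversion functor of the groupoid with the antipode of `A`. -/
def antiMor : A.obj ⟶ A.obj :=
  ⟨ξ.invFunctor,
    { app := fun x => (A.anti x.val).hom
      naturality := fun _ _ e => A.anti_natural e.2 }⟩

instance monObj : MonObj A.obj where
  one := A.oneMor
  mul := A.mulMor
  one_mul := ECat.hom_ext_same (fun x =>
    (by simp : ∀ B : Mon S, (η[B.X] ⊗ₘ 𝟙 B.X) ≫ μ[B.X] = (λ_ B.X).hom) (A.A x.val))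
  mul_one := ECat.hom_ext_same (fun x =>
    (by simp : ∀ B : Mon S, (𝟙 B.X ⊗ₘ η[B.X]) ≫ μ[B.X] = (ρ_ B.X).hom) (A.A x.val))
  mul_assoc := ECat.hom_ext_same (fun x =>
    (by simp : ∀ B : Mon S, (μ[B.X] ⊗ₘ 𝟙 B.X) ≫ μ[B.X] =
      (α_ B.X B.X B.X).hom ≫ (𝟙 B.X ⊗ₘ μ[B.X]) ≫ μ[B.X]) (A.A x.val))

instance comonObj : ComonObj A.obj where
  counit := A.counitMor
  comul := A.comulMor
  counit_comul := ECat.hom_ext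
    (CrossedModule.Gpd.functor_ext (fun d => one_mul _) (fun {d d'} f => by
      change (1 : ξ.E) * (1 : ξ.H) • f.2.1 = f.2.1
      simp)) (fun x => by
      change (A.cop 1 x.2.val).hom ≫ (A.cou.hom ⊗ₘ 𝟙 _) = eqToHom _ ≫ (λ_ _).inv
      exact A.counit_left_hom x.2.val)
  comul_counit := ECat.hom_ext
    (CrossedModule.Gpd.functor_ext (fun d => mul_one _) (fun {d d'} f => by
      change f.1.1 * d.1.val • (1 : ξ.E) = f.1.1
      simp)) (fun x => by
      change (A.cop x.1.val 1).hom ≫ (𝟙 _ ⊗ₘ A.cou.hom) = eqToHom _ ≫ (ρ_ _).inv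
      exact A.counit_right_hom x.1.val)
  comul_assoc := ECat.hom_ext
    (CrossedModule.Gpd.functor_ext (fun d => (mul_assoc _ _ _).symm) (fun {d d'} f => by
      change f.1.1 * d.1.val • (f.2.1.1 * d.2.1.val • f.2.2.1) =
        (f.1.1 * d.1.val • f.2.1.1) * (d.1.val * d.2.1.val) • f.2.2.1
      rw [smul_mul', mul_smul, mul_assoc])) (fun x => by
      change (A.cop x.1.val (x.2.1.val * x.2.2.val)).hom ≫ (𝟙 _ ⊗ₘ (A.cop _ _).hom) =
        eqToHom _ ≫ (A.cop (x.1.val * x.2.1.val) x.2.2.val).hom ≫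
          ((A.cop _ _).hom ⊗ₘ 𝟙 _) ≫ (α_ _ _ _).hom
      exact A.coassoc_hom x.1.val x.2.1.val x.2.2.val)

instance bimonObj : BimonObj A.obj where
  toMonObj := A.monObj
  toComonObj := A.comonObj
  mul_comul := ECat.hom_ext_same (fun x => by
    exact (IsMonHom.mul_hom (A.cop x.1.val x.2.val).hom).trans (congrArg
      (fun t => ((A.cop x.1.val x.2.val).hom ⊗ₘ (A.cop x.1.val x.2.val).hom) ≫ t ≫
        (μ[(A.A x.1.val).X] ⊗ₘ μ[(A.A x.2.val).X]))
      (ECat.tensorμ_app A.obj A.obj A.obj A.obj x.1 x.2 x.1 x.2).symm))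
  one_comul := ECat.hom_ext_same (fun x => by
    change η[(A.A (x.1.val * x.2.val)).X] ≫ (A.cop _ _).hom =
      (λ_ _).inv ≫ (η[(A.A x.1.val).X] ⊗ₘ η[(A.A x.2.val).X])
    simp)
  mul_counit := ECat.hom_ext_same (fun x => by
    change μ[(A.A 1).X] ≫ A.cou.hom = (A.cou.hom ⊗ₘ A.cou.hom) ≫ (λ_ _).hom
    simp)
  one_counit := ECat.hom_ext_same (fun x => by
    change η[(A.A 1).X] ≫ A.cou.hom = 𝟙 _
    simp)

instance hopfObj : HopfObj A.obj where
  toBimonObj := A.bimonObj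
  antipode := A.antiMor
  antipode_left := ECat.hom_ext
    (CrossedModule.Gpd.functor_ext (fun d => inv_mul_cancel _) (fun {d d'} f => by
      change d.val⁻¹ • f.1⁻¹ * d.val⁻¹ • f.1 = (1 : ξ.E)
      rw [← smul_mul']; simp)) (fun x => by
      change (A.cop x.val⁻¹ x.val).hom ≫ ((A.anti x.val).hom ⊗ₘ 𝟙 _) ≫ μ[(A.A x.val).X] =
        eqToHom _ ≫ A.cou.hom ≫ η[(A.A x.val).X]
      exact A.anti_left_hom x.val)
  antipode_right := ECat.hom_ext
    (CrossedModule.Gpd.functor_ext (fun d => mul_inv_cancel _) (fun {d d'} f => by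
      change f.1 * d.val • d.val⁻¹ • f.1⁻¹ = (1 : ξ.E)
      simp)) (fun x => by
      change (A.cop x.val x.val⁻¹).hom ≫ (𝟙 _ ⊗ₘ (A.anti x.val).hom) ≫ μ[(A.A x.val).X] =
        eqToHom _ ≫ A.cou.hom ≫ η[(A.A x.val).X]
      exact A.anti_right_hom x.val)

lemma tr_ac {x x' y y' : ξ.H} {e e' : ξ.E} (hx : x = x') (hy : y = y') (he : e = e')
    (h : y = ξ.bd e * x) (h' : y' = ξ.bd e' * x') :
    (A.ac e h).hom ≫ eqToHom (congrArg (fun x => (A.A x).X) hy) =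
      eqToHom (congrArg (fun x => (A.A x).X) hx) ≫ (A.ac e' h').hom := by
  subst hx
  subst hy
  subst he
  simp

lemma tr_anti {x y : ξ.H} (h : x = y) :
    (A.anti x).inv ≫ eqToHom (congrArg (fun x => (A.A x⁻¹).X) h) =
      eqToHom (congrArg (fun x => (A.A x).X) h) ≫ (A.anti y).inv := by
  subst h
  simp

/-- The inverse of the antipode. -/
def antiInvMor : A.obj ⟶ A.obj :=
  ⟨ξ.invFunctor,
    { app := fun x => (A.anti x.val⁻¹).inv ≫
        eqToHom (congrArg (fun x => (A.A x).X) (inv_inv x.val))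
      naturality := fun x y f => by
        have h := A.anti_natural (CrossedModule.inv_aux f.2)
        rw [← Iso.inv_comp_eq, ← Category.assoc, ← Iso.eq_comp_inv] at h
        have h2 := A.tr_ac (inv_inv x.val) (inv_inv y.val)
          (show x.val⁻¹⁻¹ • (x.val⁻¹ • f.1⁻¹)⁻¹ = f.1 by simp)
          (CrossedModule.inv_aux (CrossedModule.inv_aux f.2)) f.2
        change (A.ac (x.val⁻¹ • f.1⁻¹) (CrossedModule.inv_aux f.2)).hom ≫ (A.anti y.val⁻¹).inv ≫
          eqToHom _ =
          ((A.anti x.val⁻¹).inv ≫ eqToHom _) ≫ (A.ac f.1 f.2).hom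
        rw [Category.assoc, ← h2, ← Category.assoc, ← h, Category.assoc] }⟩

lemma isIso_antiMor : IsIso A.antiMor :=
  ⟨A.antiInvMor,
    ECat.hom_ext (CrossedModule.Gpd.functor_ext (fun d => inv_inv _) (fun {d d'} f => by
      change d.val⁻¹⁻¹ • (d.val⁻¹ • f.1⁻¹)⁻¹ = f.1
      simp)) (fun x => by
      change (A.anti x.val⁻¹).hom ≫ (A.anti x.val⁻¹).inv ≫ eqToHom _ = eqToHom _ ≫ 𝟙 _
      simp),
    ECat.hom_ext (CrossedModule.Gpd.functor_ext (fun d => inv_inv _) (fun {d d'} f => by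
      change d.val⁻¹⁻¹ • (d.val⁻¹ • f.1⁻¹)⁻¹ = f.1
      simp)) (fun x => by
      change ((A.anti x.val⁻¹⁻¹).inv ≫ eqToHom _) ≫ (A.anti x.val).hom = eqToHom _ ≫ 𝟙 _
      have h := A.tr_anti (inv_inv x.val)
      rw [Category.comp_id, ← Iso.eq_comp_inv]
      exact h)⟩

end HopfCoalg

/-- Hopf algebras in a braided category: bialgebras with an invertible antipode. Morphisms are
the morphisms of bialgebras (which preserve the antipodes). -/
abbrev HopfAlg (B : Type*) [Category B] [MonoidalCategory B] [BraidedCategory B] :=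
  ObjectProperty.FullSubcategory (fun X : Hopf B => IsIso (HopfObj.antipode (X := X.X)))

/-- The Hopf algebra in `𝓔(S)` associated with a pair `(ξ, A)`. -/
def HopfPair.toHopfAlg (P : HopfPair.{w} S) : HopfAlg (ECat.{w} S) :=
  ⟨⟨P.coalg.obj⟩, P.coalg.isIso_antiMor⟩

end HopfCoalg

/-!
A morphism of `𝓔(S)` contains a functor in the opposite direction, so forgetting `S` turns a Hopf
algebra `(C, F)` of `𝓔(S)` into structure on the category `C` in the cartesian category `Cat`. The
algebra part makes `C` a comonoid in `Cat`, and such a structure is unique: the product is carried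
by the diagonal functor (`ECat.mul_Γ`) and the unit by the augmentation functor (`ECat.one_Γ`). The
coalgebra part and the antipode then make `C` a group object in `Cat`, that is, a strict 2-group
(`ECat.strictTwoGroup`).

Strict 2-groups come from crossed modules. Objects and arrows of `C` form groups; the crossed
module is the target homomorphism from the arrows with source `1` to the objects, with the
conjugation action. The interchange law gives the Peiffer identity
(`StrictTwoGroup.mul_comm_of_target_of_source`) and expresses composition by the group structure,
`g ∘ f = g y⁻¹ f` for `f : x ⟶ y` and `g : y ⟶ z` (`StrictTwoGroup.mk_comp`), so `f ↦ f x⁻¹`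
identifies `C` with the groupoid of the crossed module, compatibly with the product functors. Hence
every Hopf algebra is isomorphic to one on some `𝒢_ξ` with coproduct carried by `m_ξ`
(`ECat.exists_iso_gpd`).

On `𝒢_ξ` itself, the product functor `m_ξ` determines the unit and inversion functors, as in a
group. All functor parts being fixed, a Hopf algebra structure amounts to five natural
transformations (`GpdHopfData`), whose naturality and whose Hopf algebra axioms, read componentwise,
are exactly the data and axioms of a Hopf `ξ`-coalgebra (`GpdHopfData.coalg`). The coalgebra
obtained in this way has the given Hopf algebra (`GpdHopfData.toHopfAlg_coalg`) and is the only one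
(`GpdHopfData.eq_coalg_of_toHopfAlg_eq`).

Finally, an isomorphism of Hopf algebras is an isomorphism of groupoids respecting the product
functors together with isomorphisms of the components. Since `e : x ⟶ y` is the product of
`e : 1 ⟶ ∂(e)` and the identity of `x`, the former is the same as an isomorphism of crossed modules
(`CrossedModule.val_map`), and the latter are the isomorphisms of algebras in an isomorphism of
pairs (`HopfPair.Iso.exists_iso`, `HopfPair.nonempty_iso`).
-/

/-! ### Transport of Hopf structures, and isomorphisms of Hopf algebras -/

namespace CategoryTheory

section Transport

open scoped CategoryTheory.MonObj CategoryTheory.ComonObj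

variable {B : Type*} [Category B] [MonoidalCategory B]

/-- A comonoid structure transported along an isomorphism. -/
abbrev ComonObj.transport {M X : B} [ComonObj M] (e : M ≅ X) : ComonObj X where
  counit := e.inv ≫ ε[M]
  comul := e.inv ≫ Δ[M] ≫ (e.hom ⊗ₘ e.hom)
  counit_comul := by
    simp only [Category.assoc, ← tensorHom_id, tensorHom_comp_tensorHom, Iso.hom_inv_id_assoc,
      Category.comp_id]
    have h : (ε[M] ⊗ₘ e.hom) = (ε[M] ▷ M) ≫ (𝟙_ B ◁ e.hom) := by rw [MonoidalCategory.tensorHom_def]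
    rw [h, ComonObj.counit_comul_assoc, ← leftUnitor_inv_naturality, Iso.inv_hom_id_assoc]
  comul_counit := by
    simp only [Category.assoc, ← id_tensorHom, tensorHom_comp_tensorHom, Iso.hom_inv_id_assoc,
      Category.comp_id]
    have h : (e.hom ⊗ₘ ε[M]) = (M ◁ ε[M]) ≫ (e.hom ▷ 𝟙_ B) := by rw [tensorHom_def']
    rw [h, ComonObj.comul_counit_assoc, ← rightUnitor_inv_naturality, Iso.inv_hom_id_assoc]
  comul_assoc := by
    have h1 : (e.hom ⊗ₘ e.hom) ≫ X ◁ (e.inv ≫ Δ[M] ≫ (e.hom ⊗ₘ e.hom)) =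
        M ◁ Δ[M] ≫ (e.hom ⊗ₘ (e.hom ⊗ₘ e.hom)) := by
      simp only [← id_tensorHom, tensorHom_comp_tensorHom, Iso.hom_inv_id_assoc, Category.comp_id,
        Category.id_comp]
    have h2 : (e.hom ⊗ₘ e.hom) ≫ (e.inv ≫ Δ[M] ≫ (e.hom ⊗ₘ e.hom)) ▷ X =
        Δ[M] ▷ M ≫ ((e.hom ⊗ₘ e.hom) ⊗ₘ e.hom) := by
      simp only [← tensorHom_id, tensorHom_comp_tensorHom, Iso.hom_inv_id_assoc, Category.comp_id,
        Category.id_comp]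
    simp only [Category.assoc] at h1 h2 ⊢
    rw [h1, reassoc_of% h2, ComonObj.comul_assoc_assoc, associator_naturality]

variable [BraidedCategory B]

/-- A bimonoid structure transported along an isomorphism. -/
abbrev BimonObj.transport {M X : B} [BimonObj M] (e : M ≅ X) : BimonObj X where
  toMonObj := MonObj.ofIso e
  toComonObj := ComonObj.transport e
  mul_comul := by
    change ((e.inv ⊗ₘ e.inv) ≫ μ[M] ≫ e.hom) ≫ (e.inv ≫ Δ[M] ≫ (e.hom ⊗ₘ e.hom)) =
      ((e.inv ≫ Δ[M] ≫ (e.hom ⊗ₘ e.hom)) ⊗ₘ (e.inv ≫ Δ[M] ≫ (e.hom ⊗ₘ e.hom))) ≫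
        tensorμ X X X X ≫ (((e.inv ⊗ₘ e.inv) ≫ μ[M] ≫ e.hom) ⊗ₘ ((e.inv ⊗ₘ e.inv) ≫ μ[M] ≫ e.hom))
    have h : ((e.inv ≫ Δ[M] ≫ (e.hom ⊗ₘ e.hom)) ⊗ₘ (e.inv ≫ Δ[M] ≫ (e.hom ⊗ₘ e.hom))) =
        (e.inv ⊗ₘ e.inv) ≫ (Δ[M] ⊗ₘ Δ[M]) ≫ ((e.hom ⊗ₘ e.hom) ⊗ₘ (e.hom ⊗ₘ e.hom)) := by
      simp only [tensorHom_comp_tensorHom]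
    have h' : ((e.hom ⊗ₘ e.hom) ⊗ₘ (e.hom ⊗ₘ e.hom)) ≫
        (((e.inv ⊗ₘ e.inv) ≫ μ[M] ≫ e.hom) ⊗ₘ ((e.inv ⊗ₘ e.inv) ≫ μ[M] ≫ e.hom)) =
        (μ[M] ⊗ₘ μ[M]) ≫ (e.hom ⊗ₘ e.hom) := by
      simp only [tensorHom_comp_tensorHom_assoc, tensorHom_comp_tensorHom, Iso.hom_inv_id,
        id_tensorHom_id, Category.id_comp]
    rw [h]
    simp only [Category.assoc, Iso.hom_inv_id_assoc, tensorμ_natural_assoc]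
    rw [h', BimonObj.mul_comul_assoc]
  one_comul := by
    change (η[M] ≫ e.hom) ≫ (e.inv ≫ Δ[M] ≫ (e.hom ⊗ₘ e.hom)) =
      (λ_ _).inv ≫ ((η[M] ≫ e.hom) ⊗ₘ (η[M] ≫ e.hom))
    rw [Category.assoc, Iso.hom_inv_id_assoc, Bimon.one_comul_assoc, tensorHom_comp_tensorHom]
  mul_counit := by
    change ((e.inv ⊗ₘ e.inv) ≫ μ[M] ≫ e.hom) ≫ (e.inv ≫ ε[M]) =
      ((e.inv ≫ ε[M]) ⊗ₘ (e.inv ≫ ε[M])) ≫ (λ_ _).hom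
    rw [Category.assoc, Category.assoc, Iso.hom_inv_id_assoc, Bimon.mul_counit,
      tensorHom_comp_tensorHom_assoc]
  one_counit := by
    change (η[M] ≫ e.hom) ≫ (e.inv ≫ ε[M]) = _
    rw [Category.assoc, Iso.hom_inv_id_assoc, BimonObj.one_counit]

/-- A Hopf structure transported along an isomorphism. -/
abbrev HopfObj.transport {M X : B} [HopfObj M] (e : M ≅ X) : HopfObj X where
  toBimonObj := BimonObj.transport e
  antipode := e.inv ≫ HopfObj.antipode ≫ e.hom
  antipode_left := by
    change (e.inv ≫ Δ[M] ≫ (e.hom ⊗ₘ e.hom)) ≫ (e.inv ≫ HopfObj.antipode ≫ e.hom) ▷ X ≫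
      ((e.inv ⊗ₘ e.inv) ≫ μ[M] ≫ e.hom) = (e.inv ≫ ε[M]) ≫ (η[M] ≫ e.hom)
    have h := HopfObj.antipode_left_assoc M e.hom
    simp only [← tensorHom_id, Category.assoc, tensorHom_comp_tensorHom_assoc,
      Iso.hom_inv_id_assoc, Iso.hom_inv_id, Category.comp_id, Category.id_comp] at h ⊢
    rw [h]
  antipode_right := by
    change (e.inv ≫ Δ[M] ≫ (e.hom ⊗ₘ e.hom)) ≫ X ◁ (e.inv ≫ HopfObj.antipode ≫ e.hom) ≫
      ((e.inv ⊗ₘ e.inv) ≫ μ[M] ≫ e.hom) = (e.inv ≫ ε[M]) ≫ (η[M] ≫ e.hom)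
    have h := HopfObj.antipode_right_assoc M e.hom
    simp only [← id_tensorHom, Category.assoc, tensorHom_comp_tensorHom_assoc,
      Iso.hom_inv_id_assoc, Iso.hom_inv_id, Category.comp_id, Category.id_comp] at h ⊢
    rw [h]

lemma HopfObj.isMonHom_transport {M X : B} [HopfObj M] (e : M ≅ X) :
    letI := HopfObj.transport e; IsMonHom e.hom := by
  let := HopfObj.transport e
  refine ⟨rfl, ?_⟩
  change _ = (e.hom ⊗ₘ e.hom) ≫ (e.inv ⊗ₘ e.inv) ≫ μ[M] ≫ e.hom
  simp

lemma HopfObj.isComonHom_transport {M X : B} [HopfObj M] (e : M ≅ X) :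
    letI := HopfObj.transport e; IsComonHom e.hom := by
  let := HopfObj.transport e
  refine ⟨?_, ?_⟩
  · change e.hom ≫ e.inv ≫ ε[M] = _
    simp
  · change e.hom ≫ e.inv ≫ Δ[M] ≫ (e.hom ⊗ₘ e.hom) = _
    simp

lemma HopfObj.isIso_antipode_transport {M X : B} [HopfObj M] (e : M ≅ X)
    [IsIso (HopfObj.antipode (X := M))] :
    IsIso (HopfObj.transport e).antipode :=
  inferInstanceAs (IsIso (e.inv ≫ HopfObj.antipode (X := M) ≫ e.hom))

end Transport

end CategoryTheory

section

open scoped MonObj ComonObj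

variable {B : Type*} [Category B] [MonoidalCategory B] [BraidedCategory B]

/-- Hopf algebras are isomorphic as soon as their underlying objects are isomorphic by a morphism
which respects products, units, coproducts and counits. -/
lemma HopfAlg.nonempty_iso_iff {X Y : HopfAlg B} :
    Nonempty (X ≅ Y) ↔ ∃ e : X.obj.X ≅ Y.obj.X, IsMonHom e.hom ∧ IsComonHom e.hom := by
  constructor
  · rintro ⟨e⟩
    let e1 : X.obj ≅ Y.obj := (ObjectProperty.ι _).mapIso e
    let X' : Comon (Mon B) := Hopf.toBimon X.obj
    let Y' : Comon (Mon B) := Hopf.toBimon Y.obj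
    let e2 : X' ≅ Y' := (inducedFunctor Hopf.toBimon).mapIso e1
    let e3 : X'.X ≅ Y'.X := (Bimon.toMon B).mapIso e2
    let e4 : X.obj.X ≅ Y.obj.X := (Mon.forget B).mapIso e3
    have h1 : IsMonHom e4.hom := e3.hom.isMonHom_hom
    have h2 : IsComonHom e3.hom := e2.hom.isComonHom_hom
    exact ⟨e4, h1, ⟨congrArg Mon.Hom.hom h2.hom_counit, congrArg Mon.Hom.hom h2.hom_comul⟩⟩
  · rintro ⟨e, h1, h2⟩
    let X' : Comon (Mon B) := Hopf.toBimon X.obj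
    let Y' : Comon (Mon B) := Hopf.toBimon Y.obj
    let e3 : X'.X ≅ Y'.X := Mon.mkIso' (M := X.obj.X) (N := Y.obj.X) e
    have h3 : IsComonHom e3.hom := ⟨Mon.Hom.ext h2.hom_counit, Mon.Hom.ext h2.hom_comul⟩
    let e2 : X' ≅ Y' := Comon.mkIso' e3
    exact ⟨ObjectProperty.isoMk _ (InducedCategory.isoMk e2)⟩

end

/-! ### Strict 2-groups and crossed modules -/

/-- A strict 2-group: a group object in the category of small categories, with the functor
equations that hold for the underlying category of a Hopf algebra in `𝓔(S)`. The right unit and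
right inverse laws follow from the left ones. -/
class StrictTwoGroup (C : Type w) [SmallCategory C] where
  mul : C × C ⥤ C
  unit : Discrete PUnit.{w + 1} ⥤ C
  inv : C ⥤ C
  assoc : (𝟭 C).prod mul ⋙ mul = prod.inverseAssociator C C C ⋙ mul.prod (𝟭 C) ⋙ mul
  one_mul : unit.prod (𝟭 C) ⋙ mul = CategoryTheory.Prod.snd _ C
  inv_mul : Functor.diag C ⋙ inv.prod (𝟭 C) ⋙ mul = (Functor.const C).obj ⟨PUnit.unit⟩ ⋙ unit

namespace StrictTwoGroup

section Arrow

variable {C : Type*} [Category C]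

/-- Composites in a category only depend on the composed arrows. -/
lemma mk_comp_congr {x y z x' y' z' : C} {f : x ⟶ y} {g : y ⟶ z} {f' : x' ⟶ y'} {g' : y' ⟶ z'}
    (hf : Arrow.mk f = Arrow.mk f') (hg : Arrow.mk g = Arrow.mk g') :
    Arrow.mk (f ≫ g) = Arrow.mk (f' ≫ g') := by
  obtain rfl : x = x' := congrArg (fun a : Arrow C => a.left) hf
  obtain rfl : y = y' := congrArg (fun a : Arrow C => a.right) hf
  obtain rfl : z = z' := congrArg (fun a : Arrow C => a.right) hg
  obtain rfl := Arrow.mk_injective _ _ hf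
  obtain rfl := Arrow.mk_injective _ _ hg
  rfl

lemma mk_map_congr {D : Type*} [Category D] {P Q : C ⥤ D} (h : P = Q) {x y : C} (f : x ⟶ y) :
    Arrow.mk (P.map f) = Arrow.mk (Q.map f) := by
  subst h; rfl

/-- An arrow with prescribed source and target, as a morphism. -/
def homOfArrow {x y : C} (a : Arrow C) (hx : a.left = x) (hy : a.right = y) : x ⟶ y :=
  eqToHom hx.symm ≫ a.hom ≫ eqToHom hy

lemma mk_homOfArrow {x y : C} (a : Arrow C) (hx : a.left = x) (hy : a.right = y) :
    Arrow.mk (homOfArrow a hx hy) = a := by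
  subst hx
  subst hy
  simp only [homOfArrow, eqToHom_refl, Category.comp_id, Category.id_comp]
  rfl

end Arrow

variable {C : Type w} [SmallCategory C] [StrictTwoGroup C]

instance : Mul C := ⟨fun x y => (mul (C := C)).obj (x, y)⟩

instance : One C := ⟨(unit (C := C)).obj ⟨PUnit.unit⟩⟩

instance : Inv C := ⟨fun x => (inv (C := C)).obj x⟩

/-- The objects of a strict 2-group form a group. -/
instance : Group C := Group.ofLeftAxioms
  (fun x y z => (Functor.congr_obj (assoc (C := C)) (x, y, z)).symm)
  (fun x => Functor.congr_obj (one_mul (C := C)) (⟨PUnit.unit⟩, x))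
  (fun x => Functor.congr_obj (inv_mul (C := C)) x)

instance : Mul (Arrow C) := ⟨fun a b => Arrow.mk ((mul (C := C)).map
  (X := (a.left, b.left)) (Y := (a.right, b.right)) (a.hom, b.hom))⟩

instance : One (Arrow C) := ⟨Arrow.mk (𝟙 (1 : C))⟩

instance : Inv (Arrow C) := ⟨fun a => Arrow.mk ((inv (C := C)).map a.hom)⟩

/-- The arrows of a strict 2-group form a group. -/
instance : Group (Arrow C) := Group.ofLeftAxioms
  (fun a b c => (mk_map_congr (assoc (C := C)) (x := (a.left, b.left, c.left))
    (y := (a.right, b.right, c.right)) (a.hom, b.hom, c.hom)).symm)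
  (fun a => by
    have h := mk_map_congr (one_mul (C := C)) (x := (⟨PUnit.unit⟩, a.left))
      (y := (⟨PUnit.unit⟩, a.right)) (𝟙 _, a.hom)
    change Arrow.mk ((mul (C := C)).map (X := ((1 : C), a.left)) (Y := ((1 : C), a.right))
      ((unit (C := C)).map (𝟙 _), a.hom)) = a at h
    rwa [CategoryTheory.Functor.map_id] at h)
  (fun a => by
    have h := mk_map_congr (inv_mul (C := C)) a.hom
    change _ = Arrow.mk ((unit (C := C)).map (𝟙 _)) at h
    rwa [CategoryTheory.Functor.map_id] at h)

variable (C) in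
/-- The source of an arrow. -/
def sourceHom : Arrow C →* C where
  toFun a := a.left
  map_one' := rfl
  map_mul' _ _ := rfl

variable (C) in
/-- The target of an arrow. -/
def targetHom : Arrow C →* C where
  toFun a := a.right
  map_one' := rfl
  map_mul' _ _ := rfl

variable (C) in
/-- The identity arrow of an object. -/
def idHom : C →* Arrow C where
  toFun x := Arrow.mk (𝟙 x)
  map_one' := rfl
  map_mul' x y := congrArg Arrow.mk ((mul (C := C)).map_id (x, y)).symm

@[simp] lemma sourceHom_idHom (x : C) : sourceHom C (idHom C x) = x := rfl
@[simp] lemma targetHom_idHom (x : C) : targetHom C (idHom C x) = x := rfl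

/-- The interchange law. -/
lemma mk_comp_mul_mk_comp {x y z x' y' z' : C} (f : x ⟶ y) (g : y ⟶ z) (f' : x' ⟶ y')
    (g' : y' ⟶ z') :
    Arrow.mk (f ≫ g) * Arrow.mk (f' ≫ g') =
      Arrow.mk ((mul (C := C)).map (X := (x, x')) (Y := (y, y')) (f, f') ≫
        (mul (C := C)).map (X := (y, y')) (Y := (z, z')) (g, g')) :=
  congrArg Arrow.mk ((mul (C := C)).map_comp (X := (x, x')) (Y := (y, y')) (Z := (z, z'))
    (f, f') (g, g'))

/-- Composition is determined by the group structure. -/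
lemma mk_comp {x y z : C} (f : x ⟶ y) (g : y ⟶ z) :
    Arrow.mk (f ≫ g) = Arrow.mk g * (idHom C y)⁻¹ * Arrow.mk f := by
  obtain ⟨k, hk⟩ : ∃ k : Arrow C, k = Arrow.mk g * (idHom C y)⁻¹ := ⟨_, rfl⟩
  have hk1 : k.left = 1 := by
    change sourceHom C k = 1
    rw [hk, map_mul, map_inv, sourceHom_idHom]
    exact mul_inv_cancel y
  -- Write `g` as the product of `k`, which starts at `1`, and the identity of `y`.
  have h := mk_comp_mul_mk_comp (𝟙 k.left) k.hom f (𝟙 y)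
  rw [Category.id_comp, Category.comp_id] at h
  rw [← hk]
  refine Eq.trans ?_ h.symm
  refine mk_comp_congr ?_ ?_
  · change _ = idHom C k.left * Arrow.mk f
    rw [hk1, map_one, _root_.one_mul]
  · change _ = k * idHom C y
    rw [hk, inv_mul_cancel_right]

/-- An arrow with target `1` commutes with an arrow with source `1`: both products are the
composite arrow. -/
lemma mul_comm_of_target_of_source {k f : Arrow C} (hk : targetHom C k = 1)
    (hf : sourceHom C f = 1) : k * f = f * k := by
  have h1 := mk_comp_mul_mk_comp k.hom (𝟙 k.right) (𝟙 f.left) f.hom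
  have h2 := mk_comp_mul_mk_comp (𝟙 f.left) f.hom k.hom (𝟙 k.right)
  rw [Category.id_comp, Category.comp_id] at h1 h2
  refine h1.trans (Eq.trans (mk_comp_congr ?_ ?_) h2.symm)
  · change k * idHom C (sourceHom C f) = idHom C (sourceHom C f) * k
    rw [hf, map_one, _root_.one_mul, _root_.mul_one]
  · change idHom C (targetHom C k) * f = f * idHom C (targetHom C k)
    rw [hk, map_one, _root_.one_mul, _root_.mul_one]

/-- The objects act by conjugation on the arrows with source `1`. -/
instance : MulDistribMulAction C (sourceHom C).ker where
  smul x e := ⟨idHom C x * e.1 * (idHom C x)⁻¹, by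
    have h : sourceHom C e.1 = 1 := e.2
    rw [MonoidHom.mem_ker, map_mul, map_mul, map_inv, h, _root_.mul_one, mul_inv_cancel]⟩
  one_smul e := Subtype.ext (by
    change idHom C 1 * e.1 * (idHom C 1)⁻¹ = e.1
    rw [map_one, _root_.one_mul, inv_one, _root_.mul_one])
  mul_smul x y e := Subtype.ext (by
    change idHom C (x * y) * e.1 * (idHom C (x * y))⁻¹ =
      idHom C x * (idHom C y * e.1 * (idHom C y)⁻¹) * (idHom C x)⁻¹
    rw [map_mul]; group)
  smul_mul x e f := Subtype.ext (by
    change idHom C x * (e.1 * f.1) * (idHom C x)⁻¹ =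
      (idHom C x * e.1 * (idHom C x)⁻¹) * (idHom C x * f.1 * (idHom C x)⁻¹)
    group)
  smul_one x := Subtype.ext (by
    change idHom C x * 1 * (idHom C x)⁻¹ = 1
    group)

variable (C) in
/-- The crossed module of a strict 2-group: the target homomorphism on the arrows with source
`1`, with the conjugation action of the objects. -/
def crossedModule : CrossedModule.{w} where
  E := (sourceHom C).ker
  H := C
  bd := (targetHom C).comp (sourceHom C).ker.subtype
  equivariant x e := by
    change targetHom C (idHom C x * e.1 * (idHom C x)⁻¹) = x * targetHom C e.1 * x⁻¹
    rw [map_mul, map_mul, map_inv, targetHom_idHom]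
  peiffer e f := Subtype.ext (by
    change idHom C (targetHom C e.1) * f.1 * (idHom C (targetHom C e.1))⁻¹ = e.1 * f.1 * e.1⁻¹
    have h := mul_comm_of_target_of_source
      (k := e.1⁻¹ * idHom C (targetHom C e.1)) (f := f.1)
      (by rw [map_mul, map_inv, targetHom_idHom, inv_mul_cancel]) f.2
    calc _ = e.1 * ((e.1⁻¹ * idHom C (targetHom C e.1)) * f.1) *
          (idHom C (targetHom C e.1))⁻¹ := by group
      _ = _ := by rw [h]; group)

variable (C) in
/-- The functor `x ↦ x`, `(f : x → y) ↦ f x⁻¹` to the groupoid of the crossed module. -/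
def toGpd : C ⥤ (crossedModule C).Gpd where
  obj x := ⟨x⟩
  map {x y} f := ⟨⟨Arrow.mk f * (idHom C x)⁻¹, by
      rw [MonoidHom.mem_ker, map_mul, map_inv, sourceHom_idHom]
      exact mul_inv_cancel x⟩, by
    change y = targetHom C (Arrow.mk f * (idHom C x)⁻¹) * x
    rw [map_mul, map_inv, targetHom_idHom]
    exact (inv_mul_cancel_right y x).symm⟩
  map_id x := Subtype.ext (Subtype.ext (mul_inv_cancel (idHom C x)))
  map_comp {x y z} f g := Subtype.ext (Subtype.ext (by
    change Arrow.mk (f ≫ g) * (idHom C x)⁻¹ =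
      (Arrow.mk g * (idHom C y)⁻¹) * (Arrow.mk f * (idHom C x)⁻¹)
    rw [mk_comp]; group))

lemma toGpd_map_val {x y : C} (f : x ⟶ y) :
    (Subtype.val ((toGpd C).map f)).1 = Arrow.mk f * (idHom C x)⁻¹ := rfl

lemma toGpd_map_injective {x y : C} {f g : x ⟶ y} (h : (toGpd C).map f = (toGpd C).map g) :
    f = g :=
  Arrow.mk_injective _ _ (mul_right_cancel
    (congrArg (fun t => (Subtype.val t).1) h : Arrow.mk f * (idHom C x)⁻¹ =
      Arrow.mk g * (idHom C x)⁻¹))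

/-- A morphism of the groupoid of the crossed module of a strict 2-group, as a morphism of the
2-group. -/
def gpdHom {x y : (crossedModule C).Gpd} (e : x ⟶ y) : (show C from x.val) ⟶ (show C from y.val) :=
  homOfArrow (e.1.1 * idHom C x.val)
    (by
      have h : sourceHom C e.1.1 = 1 := e.1.2
      change sourceHom C (e.1.1 * idHom C x.val) = x.val
      rw [map_mul, h, _root_.one_mul]; rfl)
    (by
      change targetHom C (e.1.1 * idHom C x.val) = y.val
      rw [map_mul]
      exact e.2.symm)

lemma toGpd_map_gpdHom {x y : (crossedModule C).Gpd} (e : x ⟶ y) :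
    (toGpd C).map (gpdHom e) = e := by
  refine Subtype.ext (Subtype.ext ?_)
  rw [toGpd_map_val, gpdHom, mk_homOfArrow]
  exact mul_inv_cancel_right _ _

variable (C) in
/-- The inverse of `toGpd`. -/
def ofGpd : (crossedModule C).Gpd ⥤ C where
  obj x := x.val
  map e := gpdHom e
  map_id x := toGpd_map_injective (by
    rw [toGpd_map_gpdHom]; exact ((toGpd C).map_id x.val).symm)
  map_comp e f := toGpd_map_injective (by
    rw [toGpd_map_gpdHom]
    refine Eq.trans ?_ ((toGpd C).map_comp (gpdHom e) (gpdHom f)).symm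
    exact (congrArg₂ (· ≫ ·) (toGpd_map_gpdHom e) (toGpd_map_gpdHom f)).symm)

lemma ofGpd_comp_toGpd : ofGpd C ⋙ toGpd C = 𝟭 _ :=
  CrossedModule.Gpd.functor_ext (fun _ => rfl) (fun f => congrArg Subtype.val (toGpd_map_gpdHom f))

lemma toGpd_comp_ofGpd : toGpd C ⋙ ofGpd C = 𝟭 _ :=
  CategoryTheory.Functor.ext (fun _ => rfl) (fun x y f => by
    change gpdHom ((toGpd C).map f) = 𝟙 x ≫ f ≫ 𝟙 y
    rw [Category.comp_id, Category.id_comp]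
    exact toGpd_map_injective (toGpd_map_gpdHom _))

/-- Under `toGpd`, the product of the 2-group is the product functor of the crossed module. -/
lemma ofGpd_prod_mul_toGpd :
    (ofGpd C).prod (ofGpd C) ⋙ mul ⋙ toGpd C = (crossedModule C).mulFunctor :=
  CrossedModule.Gpd.functor_ext (fun _ => rfl) (fun {p q} f => Subtype.ext (by
    change (Arrow.mk (gpdHom f.1) * Arrow.mk (gpdHom f.2)) *
        (idHom C ((show C from p.1.val) * (show C from p.2.val)))⁻¹ =
      f.1.1.1 * (idHom C p.1.val * f.2.1.1 * (idHom C p.1.val)⁻¹)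
    rw [gpdHom, gpdHom, mk_homOfArrow, mk_homOfArrow, map_mul]
    group))

end StrictTwoGroup

/-! ### Functor parts of morphisms of `𝓔(S)` -/

namespace ECat

section Cat

variable {S : Type u} [Category.{v} S]

lemma app_of_eq {X Y : ECat.{w} S} {f g : X ⟶ Y} (h : f = g) (y : Y.C) :
    (Hom.γ f).app y = eqToHom (by rw [h]) ≫ (Hom.γ g).app y := by
  subst h
  simp

/-- The case of `app_of_eq` where both functors are literally the same. -/
lemma app_of_eq_same {X Y : ECat.{w} S} {Γ : Y.C ⥤ X.C} {γ γ' : Γ ⋙ X.F ⟶ Y.F}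
    (h : (Hom.mk Γ γ : X ⟶ Y) = Hom.mk Γ γ') (y : Y.C) : γ.app y = γ'.app y :=
  (app_of_eq h y).trans (Category.id_comp _)

lemma natTrans_eq_of_eq {X Y : ECat.{w} S} {Γ : Y.C ⥤ X.C} {γ γ' : Γ ⋙ X.F ⟶ Y.F}
    (h : (Hom.mk Γ γ : X ⟶ Y) = Hom.mk Γ γ') : γ = γ' :=
  NatTrans.ext (funext (app_of_eq_same h))

lemma exists_eq_mk {X Y : ECat.{w} S} (f : X ⟶ Y) {Γ : Y.C ⥤ X.C} (h : Hom.Γ f = Γ) :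
    ∃ γ : Γ ⋙ X.F ⟶ Y.F, f = Hom.mk Γ γ := by
  subst h
  exact ⟨Hom.γ f, rfl⟩

/-- The components of an isomorphism of `𝓔(S)` are isomorphisms: they are split by the components
of the inverse. -/
lemma isIso_app {X Y : ECat.{w} S} (f : X ⟶ Y) [IsIso f] (y : Y.C) : IsIso ((Hom.γ f).app y) := by
  have h1 := app_of_eq (IsIso.inv_hom_id f) y
  have h2 := app_of_eq (IsIso.hom_inv_id f) ((Hom.Γ f).obj y)
  rw [comp_γ_app] at h1 h2
  -- `f ≫ inv f = 𝟙` splits the component of `f` at the image of `y` under both functors, which is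
  -- equal to `y`, but not by definition.
  have hy : (Hom.Γ (inv f)).obj ((Hom.Γ f).obj y) = y :=
    Functor.congr_obj (congrArg Hom.Γ (IsIso.inv_hom_id f)) y
  have h4 : ∀ y' : Y.C, y' = y → IsSplitMono ((Hom.γ f).app y') →
      IsSplitMono ((Hom.γ f).app y) := by
    rintro y' rfl h; exact h
  have : IsSplitMono ((Hom.γ f).app y) := h4 _ hy (IsSplitMono.mk' ⟨(Hom.γ (inv f)).app _ ≫
    eqToHom (congrArg (fun T : X.C ⥤ X.C => X.F.obj (T.obj ((Hom.Γ f).obj y)))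
      (congrArg Hom.Γ (IsIso.hom_inv_id f)).symm), by
    rw [← Category.assoc, h2, id_γ_app]
    simp⟩)
  have : IsSplitEpi ((Hom.γ f).app y) := IsSplitEpi.mk' ⟨eqToHom
    (congrArg (fun T : Y.C ⥤ Y.C => Y.F.obj (T.obj y))
      (congrArg Hom.Γ (IsIso.inv_hom_id f)).symm) ≫ (Hom.γ (inv f)).app _, by
    rw [Category.assoc, h1, id_γ_app]
    simp⟩
  exact isIso_of_mono_of_isSplitEpi _

/-- The isomorphism of `𝓔(S)` given by an isomorphism of categories and a natural isomorphism. -/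
def isoMk {X Y : ECat.{w} S} (Γ : Y.C ⥤ X.C) (Γ' : X.C ⥤ Y.C) (h : Γ' ⋙ Γ = 𝟭 X.C)
    (h' : Γ ⋙ Γ' = 𝟭 Y.C) (γ : Γ ⋙ X.F ≅ Y.F) : X ≅ Y where
  hom := Hom.mk Γ γ.hom
  inv := Hom.mk Γ' (Functor.whiskerLeft Γ' γ.inv ≫
    eqToHom (show Γ' ⋙ Γ ⋙ X.F = X.F by rw [← Functor.assoc, h, Functor.id_comp]))
  hom_inv_id := hom_ext h (fun x => by
    change γ.hom.app _ ≫ γ.inv.app _ ≫ _ = _ ≫ 𝟙 _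
    simp)
  inv_hom_id := hom_ext h' (fun y => by
    have hn := γ.hom.naturality (eqToHom (Functor.congr_obj h' y))
    simp only [Functor.comp_map, eqToHom_map] at hn
    change (γ.inv.app _ ≫ _) ≫ γ.hom.app y = _ ≫ 𝟙 _
    rw [Category.assoc, Category.comp_id]
    simp only [eqToHom_app]
    refine (congrArg _ hn).trans ?_
    simp)

end Cat

section Monoidal

variable {S : Type u} [Category.{v} S] [MonoidalCategory S]

open scoped MonObj ComonObj

/-- The unit of a monoid of `𝓔(S)` is carried by the augmentation functor. -/
lemma one_Γ (X : ECat.{w} S) [MonObj X] :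
    Hom.Γ η[X] = (Functor.const X.C).obj ⟨PUnit.unit⟩ :=
  Functor.punit_ext' (C := X.C) _ _

/-- The product of a monoid of `𝓔(S)` is carried by the diagonal functor: this is the
uniqueness of comonoid structures in `Cat`. -/
lemma mul_Γ (X : ECat.{w} S) [MonObj X] : Hom.Γ μ[X] = Functor.diag X.C := by
  have h1 : Hom.Γ μ[X] ⋙ CategoryTheory.Prod.snd X.C X.C = 𝟭 X.C :=
    congrArg (fun T : X.C ⥤ unit.{w}.C × X.C => T ⋙ CategoryTheory.Prod.snd _ _)
      (congrArg Hom.Γ (MonObj.one_mul X))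
  have h2 : Hom.Γ μ[X] ⋙ CategoryTheory.Prod.fst X.C X.C = 𝟭 X.C :=
    congrArg (fun T : X.C ⥤ X.C × unit.{w}.C => T ⋙ CategoryTheory.Prod.fst _ _)
      (congrArg Hom.Γ (MonObj.mul_one X))
  have h3 : Functor.prod' (Hom.Γ μ[X] ⋙ CategoryTheory.Prod.fst X.C X.C)
      (Hom.Γ μ[X] ⋙ CategoryTheory.Prod.snd X.C X.C) = Functor.diag X.C := by
    rw [h1, h2]; rfl
  exact h3

end Monoidal

section Symmetric

variable {S : Type u} [Category.{v} S] [MonoidalCategory S] [SymmetricCategory S]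

open scoped MonObj ComonObj

/-- The category underlying a Hopf algebra of `𝓔(S)` is a strict 2-group. -/
abbrev strictTwoGroup (X : ECat.{w} S) [HopfObj X] : StrictTwoGroup X.C where
  mul := Hom.Γ Δ[X]
  unit := Hom.Γ ε[X]
  inv := Hom.Γ (HopfObj.antipode (X := X))
  assoc := congrArg Hom.Γ (ComonObj.comul_assoc X)
  one_mul := congrArg Hom.Γ (ComonObj.counit_comul X)
  inv_mul := by
    have h := congrArg Hom.Γ (HopfObj.antipode_left X)
    change (Hom.Γ μ[X] ⋙ _) ⋙ _ = Hom.Γ η[X] ⋙ _ at h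
    rw [mul_Γ, one_Γ] at h
    exact h

/-- Every Hopf algebra of `𝓔(S)` is isomorphic to one carried by the groupoid of a crossed
module, with coproduct carried by the product functor. -/
lemma exists_iso_gpd (X : ECat.{w} S) [HopfObj X] :
    ∃ (ξ : CrossedModule.{w}) (F : ξ.Gpd ⥤ S) (e : X ≅ ECat.mk ξ.Gpd F),
      Hom.Γ (HopfObj.transport e).toBimonObj.toComonObj.comul = ξ.mulFunctor := by
  let := strictTwoGroup X
  refine ⟨StrictTwoGroup.crossedModule X.C, StrictTwoGroup.ofGpd X.C ⋙ X.F,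
    isoMk (StrictTwoGroup.ofGpd X.C) (StrictTwoGroup.toGpd X.C)
      (StrictTwoGroup.toGpd_comp_ofGpd (C := X.C)) (StrictTwoGroup.ofGpd_comp_toGpd (C := X.C))
      (Iso.refl _), ?_⟩
  exact StrictTwoGroup.ofGpd_prod_mul_toGpd (C := X.C)

/-- Two Hopf algebras of `𝓔(S)` on the same category are equal if their functors to `S` are
equal, their structure morphisms have the same functor parts, and the components of their
structure morphisms are equal. The components are compared by heterogeneous equalities because
the functors to `S` need not agree definitionally. -/
lemma hopf_mk_eq {C : Type w} [SmallCategory C] {F G : C ⥤ S} (h : F = G)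
    (i : HopfObj (ECat.mk C F)) (j : HopfObj (ECat.mk C G))
    {Γ₁ : C ⥤ (𝟙_ (ECat.{w} S)).C} {a₁ b₁} (ha₁ : i.one = ⟨Γ₁, a₁⟩) (hb₁ : j.one = ⟨Γ₁, b₁⟩)
    (hab₁ : ∀ x, a₁.app x ≍ b₁.app x)
    {Γ₂ : C ⥤ C × C} {a₂ b₂} (ha₂ : i.mul = ⟨Γ₂, a₂⟩) (hb₂ : j.mul = ⟨Γ₂, b₂⟩)
    (hab₂ : ∀ x, a₂.app x ≍ b₂.app x)
    {Γ₃ : (𝟙_ (ECat.{w} S)).C ⥤ C} {a₃ b₃} (ha₃ : i.counit = ⟨Γ₃, a₃⟩)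
    (hb₃ : j.counit = ⟨Γ₃, b₃⟩) (hab₃ : ∀ x, a₃.app x ≍ b₃.app x)
    {Γ₄ : C × C ⥤ C} {a₄ b₄} (ha₄ : i.comul = ⟨Γ₄, a₄⟩) (hb₄ : j.comul = ⟨Γ₄, b₄⟩)
    (hab₄ : ∀ x, a₄.app x ≍ b₄.app x)
    {Γ₅ : C ⥤ C} {a₅ b₅} (ha₅ : i.antipode = ⟨Γ₅, a₅⟩) (hb₅ : j.antipode = ⟨Γ₅, b₅⟩)
    (hab₅ : ∀ x, a₅.app x ≍ b₅.app x) :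
    Hopf.mk (ECat.mk C F) (hopf := i) = Hopf.mk (ECat.mk C G) (hopf := j) := by
  subst h
  congr 1
  have e₁ : i.one = j.one := by
    rw [ha₁, hb₁]; exact hom_ext_same fun x => eq_of_heq (hab₁ x)
  have e₂ : i.mul = j.mul := by
    rw [ha₂, hb₂]; exact hom_ext_same fun x => eq_of_heq (hab₂ x)
  have e₃ : i.counit = j.counit := by
    rw [ha₃, hb₃]; exact hom_ext_same fun x => eq_of_heq (hab₃ x)
  have e₄ : i.comul = j.comul := by
    rw [ha₄, hb₄]; exact hom_ext_same fun x => eq_of_heq (hab₄ x)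
  have e₅ : i.antipode = j.antipode := by
    rw [ha₅, hb₅]; exact hom_ext_same fun x => eq_of_heq (hab₅ x)
  clear ha₁ hb₁ ha₂ hb₂ ha₃ hb₃ ha₄ hb₄ ha₅ hb₅
  obtain @⟨@⟨⟨_, _, _, _, _⟩, ⟨_, _, _, _, _⟩, _, _, _, _⟩, _, _, _⟩ := i
  obtain @⟨@⟨⟨_, _, _, _, _⟩, ⟨_, _, _, _, _⟩, _, _, _, _⟩, _, _, _⟩ := j
  dsimp only at e₁ e₂ e₃ e₄ e₅
  subst e₁ e₂ e₃ e₄ e₅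
  rfl

end Symmetric

end ECat

/-! ### Hopf algebras on the groupoid of a crossed module -/

namespace CrossedModule

variable {ξ ξ' : CrossedModule.{w}}

lemma Gpd.val_map_congr {D : Type*} [Category D] {P Q : D ⥤ ξ.Gpd} (h : P = Q) {d d' : D}
    (f : d ⟶ d') : Subtype.val (P.map f) = Subtype.val (Q.map f) := by
  subst h; rfl

/-- A functor from the trivial category which is a left unit for the product functor is the unit
functor. -/
lemma eq_unitFunctor {T : Discrete PUnit.{w + 1} ⥤ ξ.Gpd}
    (h : T.prod (𝟭 ξ.Gpd) ⋙ ξ.mulFunctor = CategoryTheory.Prod.snd _ _) : T = ξ.unitFunctor :=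
  Gpd.functor_ext
    (fun p => (mul_one (T.obj p).val).symm.trans
      (congrArg Gpd.val (Functor.congr_obj h (p, ⟨1⟩))))
    (fun {p q} f => by
      obtain rfl : p = q := Subsingleton.elim p q
      rw [Discrete.functor_map_id, Discrete.functor_map_id]
      rfl)

/-- A functor which is a left inverse for the product functor is the inversion functor. -/
lemma eq_invFunctor {T : ξ.Gpd ⥤ ξ.Gpd}
    (h : Functor.diag ξ.Gpd ⋙ T.prod (𝟭 ξ.Gpd) ⋙ ξ.mulFunctor =
      (Functor.const ξ.Gpd).obj ⟨PUnit.unit⟩ ⋙ ξ.unitFunctor) : T = ξ.invFunctor := by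
  have ho : ∀ x, (T.obj x).val = x.val⁻¹ := fun x =>
    eq_inv_of_mul_eq_one_left (congrArg Gpd.val (Functor.congr_obj h x))
  refine Gpd.functor_ext ho (fun {x y} f => ?_)
  have h1 : Subtype.val (T.map f) * (T.obj x).val • f.1 = 1 := Gpd.val_map_congr h f
  exact (eq_inv_of_mul_eq_one_left h1).trans
    ((congrArg (fun t => (t • f.1)⁻¹) (ho x)).trans (smul_inv' _ _).symm)

lemma Gpd.eqToHom_eq_map {T : Type*} [Category T] (F : ξ.Gpd ⥤ T) {x y : ξ.H} (h : x = y) :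
    eqToHom (congrArg (fun x => F.obj ⟨x⟩) h) = F.map (eqToHom (congrArg Gpd.of h)) := by
  subst h; simp

/-- A morphism `e : x → ∂(e) x` of the groupoid of a crossed module, as an isomorphism. -/
def Gpd.iso (x : ξ.H) (e : ξ.E) : (⟨x⟩ : ξ.Gpd) ≅ ⟨ξ.bd e * x⟩ where
  hom := ⟨e, rfl⟩
  inv := ⟨e⁻¹, by rw [map_inv, inv_mul_cancel_left]⟩
  hom_inv_id := Subtype.ext (inv_mul_cancel e)
  inv_hom_id := Subtype.ext (mul_inv_cancel e)

end CrossedModule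

namespace CategoryTheory

section

variable {B : Type*} [Category B] [MonoidalCategory B]

open scoped CategoryTheory.MonObj

lemma Mon.eqToHom_hom {M N : Mon B} (h : M = N) :
    (eqToHom h).hom = eqToHom (congrArg Mon.X h) := by
  subst h; rfl

/-- A monoid object, from axioms stated without whiskerings. -/
abbrev MonObj.ofTensorHom (X : B) (one : 𝟙_ B ⟶ X) (mul : X ⊗ X ⟶ X)
    (one_mul : (one ⊗ₘ 𝟙 X) ≫ mul = (λ_ X).hom) (mul_one : (𝟙 X ⊗ₘ one) ≫ mul = (ρ_ X).hom)
    (mul_assoc : (mul ⊗ₘ 𝟙 X) ≫ mul = (α_ X X X).hom ≫ (𝟙 X ⊗ₘ mul) ≫ mul) : MonObj X where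
  one := one
  mul := mul
  one_mul := by rw [← tensorHom_id, one_mul]
  mul_one := by rw [← id_tensorHom, mul_one]
  mul_assoc := by rw [← tensorHom_id, ← id_tensorHom, mul_assoc]

end

end CategoryTheory

section

variable {S : Type u} [Category.{v} S] [MonoidalCategory S] [SymmetricCategory S]

open scoped MonObj ComonObj

variable {ξ : CrossedModule.{w}}

namespace HopfCoalg

/-- A Hopf `ξ`-coalgebra, from axioms stated as equations in `S` without whiskerings. This is the
form in which they appear as components of the axioms of a Hopf algebra of `𝓔(S)`. -/
def ofTensorHom (A : ξ.H → Mon S) (cop : ∀ x y : ξ.H, A (x * y) ⟶ A x ⊗ A y)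
    (cou : A 1 ⟶ 𝟙_ (Mon S)) (anti : ∀ x : ξ.H, (A x⁻¹).X ≅ (A x).X)
    (act : ∀ (x : ξ.H) (e : ξ.E), A x ≅ A (ξ.bd e * x))
    (coassoc : ∀ x y z : ξ.H,
      (cop x (y * z)).hom ≫ (𝟙 (A x).X ⊗ₘ (cop y z).hom) =
        eqToHom (congrArg (fun x => (A x).X) (mul_assoc x y z).symm) ≫ (cop (x * y) z).hom ≫
          ((cop x y).hom ⊗ₘ 𝟙 (A z).X) ≫ (α_ (A x).X (A y).X (A z).X).hom)
    (counit_left : ∀ x : ξ.H, (cop 1 x).hom ≫ (cou.hom ⊗ₘ 𝟙 (A x).X) =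
      eqToHom (congrArg (fun x => (A x).X) (one_mul x)) ≫ (λ_ (A x).X).inv)
    (counit_right : ∀ x : ξ.H, (cop x 1).hom ≫ (𝟙 (A x).X ⊗ₘ cou.hom) =
      eqToHom (congrArg (fun x => (A x).X) (mul_one x)) ≫ (ρ_ (A x).X).inv)
    (anti_left : ∀ x : ξ.H, (cop x⁻¹ x).hom ≫ ((anti x).hom ⊗ₘ 𝟙 (A x).X) ≫ μ[(A x).X] =
      eqToHom (congrArg (fun x => (A x).X) (inv_mul_cancel x)) ≫ cou.hom ≫ η[(A x).X])
    (anti_right : ∀ x : ξ.H, (cop x x⁻¹).hom ≫ (𝟙 (A x).X ⊗ₘ (anti x).hom) ≫ μ[(A x).X] =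
      eqToHom (congrArg (fun x => (A x).X) (mul_inv_cancel x)) ≫ cou.hom ≫ η[(A x).X])
    (act_one : ∀ x : ξ.H, (act x 1).hom.hom =
      eqToHom (congrArg (fun x => (A x).X) (by rw [map_one, one_mul])))
    (act_mul : ∀ (x : ξ.H) (e f : ξ.E),
      (act x e).hom.hom ≫ (act (ξ.bd e * x) f).hom.hom =
        (act x (f * e)).hom.hom ≫
          eqToHom (congrArg (fun x => (A x).X) (by rw [map_mul, mul_assoc])))
    (act_cop : ∀ (x y : ξ.H) (e f : ξ.E),
      (cop x y).hom ≫ ((act x e).hom.hom ⊗ₘ (act y f).hom.hom) =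
        (act (x * y) (e * x • f)).hom.hom ≫
          eqToHom (congrArg (fun x => (A x).X) (CrossedModule.mul_aux rfl rfl).symm) ≫
            (cop (ξ.bd e * x) (ξ.bd f * y)).hom) : HopfCoalg S ξ where
  A := A
  cop := cop
  cou := cou
  anti := anti
  act := act
  coassoc x y z := Mon.Hom.ext (by
    have h := coassoc x y z
    simp only [Mon.comp_hom', Mon.whiskerLeft_hom, Mon.whiskerRight_hom,
      Mon.associator_hom_hom, Mon.eqToHom_hom]
    rw [← id_tensorHom, ← tensorHom_id, h, eqToHom_trans_assoc, eqToHom_refl, Category.id_comp])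
  counit_left x := Mon.Hom.ext (by
    simp only [Mon.comp_hom', Mon.leftUnitor_hom_hom, Mon.eqToHom_hom]
    have h := counit_left x
    rw [tensorHom_id] at h
    refine (Category.assoc _ _ _).symm.trans ((congrArg (· ≫ (λ_ (A x).X).hom) h).trans ?_)
    simp)
  counit_right x := Mon.Hom.ext (by
    simp only [Mon.comp_hom', Mon.rightUnitor_hom_hom, Mon.eqToHom_hom]
    have h := counit_right x
    rw [id_tensorHom] at h
    refine (Category.assoc _ _ _).symm.trans ((congrArg (· ≫ (ρ_ (A x).X).hom) h).trans ?_)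
    simp)
  anti_left x := by
    rw [Mon.eqToHom_hom, ← tensorHom_id]
    exact anti_left x
  anti_right x := by
    rw [Mon.eqToHom_hom, ← id_tensorHom]
    exact anti_right x
  act_one x := Mon.Hom.ext (by rw [Mon.eqToHom_hom]; exact act_one x)
  act_mul x e f := Mon.Hom.ext (by
    rw [Mon.comp_hom', Mon.comp_hom', Mon.eqToHom_hom]; exact act_mul x e f)
  act_cop x y e f := Mon.Hom.ext (by
    rw [Mon.comp_hom', Mon.comp_hom', Mon.comp_hom', Mon.eqToHom_hom]; exact act_cop x y e f)

/-- Hopf `ξ`-coalgebras are equal if their data are equal. -/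
lemma ext_of_heq {A B : HopfCoalg S ξ} (h₁ : A.A = B.A) (h₂ : A.cop ≍ B.cop)
    (h₃ : A.cou ≍ B.cou) (h₄ : A.anti ≍ B.anti) (h₅ : A.act ≍ B.act) : A = B := by
  obtain ⟨_, _, _, _, _, _, _, _, _, _, _, _, _⟩ := A
  obtain ⟨_, _, _, _, _, _, _, _, _, _, _, _, _⟩ := B
  dsimp only at h₁
  subst h₁
  obtain rfl := eq_of_heq h₂
  obtain rfl := eq_of_heq h₃
  obtain rfl := eq_of_heq h₄
  obtain rfl := eq_of_heq h₅
  rfl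

end HopfCoalg

/-- The natural transformations underlying the structure morphisms of a Hopf algebra
`(𝒢_ξ, F)` of `𝓔(S)` whose functor parts are those of the Hopf algebra of a Hopf
`ξ`-coalgebra. -/
structure GpdHopfData (F : ξ.Gpd ⥤ S) [HopfObj (ECat.mk ξ.Gpd F)] where
  one : (Functor.const ξ.Gpd).obj ⟨PUnit.unit⟩ ⋙
    (Functor.const (Discrete PUnit.{w + 1})).obj (𝟙_ S) ⟶ F
  one_eq : η[ECat.mk ξ.Gpd F] = ECat.Hom.mk ((Functor.const ξ.Gpd).obj ⟨PUnit.unit⟩) one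
  mul : Functor.diag ξ.Gpd ⋙ (F.prod F ⋙ MonoidalCategory.tensor S) ⟶ F
  mul_eq : μ[ECat.mk ξ.Gpd F] = ECat.Hom.mk (Functor.diag ξ.Gpd) mul
  counit : ξ.unitFunctor ⋙ F ⟶ (Functor.const (Discrete PUnit.{w + 1})).obj (𝟙_ S)
  counit_eq : ε[ECat.mk ξ.Gpd F] = ECat.Hom.mk ξ.unitFunctor counit
  comul : ξ.mulFunctor ⋙ F ⟶ (F.prod F ⋙ MonoidalCategory.tensor S)
  comul_eq : Δ[ECat.mk ξ.Gpd F] = ECat.Hom.mk ξ.mulFunctor comul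
  anti : ξ.invFunctor ⋙ F ⟶ F
  anti_eq : HopfObj.antipode (X := ECat.mk ξ.Gpd F) = ECat.Hom.mk ξ.invFunctor anti

namespace GpdHopfData

section

variable {F : ξ.Gpd ⥤ S} [HopfObj (ECat.mk ξ.Gpd F)]

/-- The product functor of the groupoid determines the unit and inversion functors, as it does
for a group. -/
lemma nonempty (h : ECat.Hom.Γ Δ[ECat.mk ξ.Gpd F] = ξ.mulFunctor) :
    Nonempty (GpdHopfData F) := by
  have hu : ECat.Hom.Γ ε[ECat.mk ξ.Gpd F] = ξ.unitFunctor :=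
    CrossedModule.eq_unitFunctor (by
      rw [← h]; exact congrArg ECat.Hom.Γ (ComonObj.counit_comul (ECat.mk ξ.Gpd F)))
  have hi : ECat.Hom.Γ (HopfObj.antipode (X := ECat.mk ξ.Gpd F)) = ξ.invFunctor :=
    CrossedModule.eq_invFunctor (by
      have h1 := (ECat.strictTwoGroup (ECat.mk ξ.Gpd F)).inv_mul
      change _ ⋙ _ ⋙ ECat.Hom.Γ Δ[ECat.mk ξ.Gpd F] = _ ⋙ ECat.Hom.Γ ε[ECat.mk ξ.Gpd F] at h1
      rw [h, hu] at h1
      exact h1)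
  obtain ⟨one, h1⟩ := ECat.exists_eq_mk _ (ECat.one_Γ (ECat.mk ξ.Gpd F))
  obtain ⟨mul, h2⟩ := ECat.exists_eq_mk _ (ECat.mul_Γ (ECat.mk ξ.Gpd F))
  obtain ⟨counit, h3⟩ := ECat.exists_eq_mk _ hu
  obtain ⟨comul, h4⟩ := ECat.exists_eq_mk _ h
  obtain ⟨anti, h5⟩ := ECat.exists_eq_mk _ hi
  exact ⟨⟨one, h1, mul, h2, counit, h3, comul, h4, anti, h5⟩⟩

variable (s : GpdHopfData F)

/-- The algebra `F(x)`. -/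
def alg (x : ξ.H) : Mon S where
  X := F.obj ⟨x⟩
  mon := MonObj.ofTensorHom (F.obj ⟨x⟩) (s.one.app ⟨x⟩) (s.mul.app ⟨x⟩)
    (by
      have h := MonObj.one_mul (ECat.mk ξ.Gpd F)
      rw [s.one_eq, s.mul_eq] at h
      exact ECat.app_of_eq_same h (⟨x⟩ : ξ.Gpd))
    (by
      have h := MonObj.mul_one (ECat.mk ξ.Gpd F)
      rw [s.one_eq, s.mul_eq] at h
      exact ECat.app_of_eq_same h (⟨x⟩ : ξ.Gpd))
    (by
      have h := MonObj.mul_assoc (ECat.mk ξ.Gpd F)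
      rw [s.mul_eq] at h
      exact ECat.app_of_eq_same h (⟨x⟩ : ξ.Gpd))

lemma isMonHom_comul (x y : ξ.H) :
    IsMonHom (M := (s.alg (x * y)).X) (N := (s.alg x ⊗ s.alg y).X)
      (s.comul.app ((⟨x⟩, ⟨y⟩) : ξ.Gpd × ξ.Gpd)) := by
  have h1 := Bimon.one_comul (ECat.mk ξ.Gpd F)
  have h2 := BimonObj.mul_comul (ECat.mk ξ.Gpd F)
  rw [s.one_eq, s.comul_eq] at h1
  rw [s.mul_eq, s.comul_eq] at h2
  refine ⟨ECat.app_of_eq_same h1 ((⟨x⟩, ⟨y⟩) : ξ.Gpd × ξ.Gpd), ?_⟩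
  refine (ECat.app_of_eq_same h2 ((⟨x⟩, ⟨y⟩) : ξ.Gpd × ξ.Gpd)).trans ?_
  exact congrArg (fun t => (s.comul.app _ ⊗ₘ s.comul.app _) ≫ t ≫ (s.mul.app ⟨x⟩ ⊗ₘ s.mul.app ⟨y⟩))
    (ECat.tensorμ_app (ECat.mk ξ.Gpd F) (ECat.mk ξ.Gpd F) (ECat.mk ξ.Gpd F) (ECat.mk ξ.Gpd F)
      (⟨x⟩ : ξ.Gpd) (⟨y⟩ : ξ.Gpd) (⟨x⟩ : ξ.Gpd) (⟨y⟩ : ξ.Gpd))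

lemma isMonHom_counit :
    IsMonHom (M := (s.alg 1).X) (N := (𝟙_ (Mon S)).X) (s.counit.app ⟨PUnit.unit⟩) := by
  have h1 := BimonObj.one_counit (ECat.mk ξ.Gpd F)
  have h2 := Bimon.mul_counit (ECat.mk ξ.Gpd F)
  rw [s.one_eq, s.counit_eq] at h1
  rw [s.mul_eq, s.counit_eq] at h2
  exact ⟨ECat.app_of_eq_same h1 _, ECat.app_of_eq_same h2 _⟩

lemma isMonHom_map {x y : ξ.H} (e : (⟨x⟩ : ξ.Gpd) ⟶ ⟨y⟩) :
    IsMonHom (M := (s.alg x).X) (N := (s.alg y).X) (F.map e) :=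
  ⟨(s.one.naturality e).symm.trans (Category.id_comp _), (s.mul.naturality e).symm⟩

/-- The components of the antipode are invertible, as those of every isomorphism of `𝓔(S)`. -/
lemma isIso_anti [IsIso (HopfObj.antipode (X := ECat.mk ξ.Gpd F))] (x : ξ.Gpd) :
    IsIso (s.anti.app x) := by
  have h := ECat.isIso_app (HopfObj.antipode (X := ECat.mk ξ.Gpd F))
  rw [s.anti_eq] at h
  exact h x

/-- The algebra isomorphism `φ_{x,e}`. -/
def act (x : ξ.H) (e : ξ.E) : s.alg x ≅ s.alg (ξ.bd e * x) :=
  have : IsMonHom (M := (s.alg x).X) (N := (s.alg (ξ.bd e * x)).X)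
    (F.mapIso (CrossedModule.Gpd.iso x e)).hom := s.isMonHom_map _
  Mon.mkIso' (M := (s.alg x).X) (N := (s.alg (ξ.bd e * x)).X)
    (F.mapIso (CrossedModule.Gpd.iso x e))

/-- The Hopf `ξ`-coalgebra with components the `F(x)`. Its coalgebra and antipode axioms are the
components of those of the Hopf algebra; the axioms of the action are the functoriality of `F` and
the naturality of the coproduct. -/
noncomputable def coalg [IsIso (HopfObj.antipode (X := ECat.mk ξ.Gpd F))] : HopfCoalg S ξ :=
  HopfCoalg.ofTensorHom s.alg
    (fun x y => @Mon.Hom.mk _ _ _ (s.alg (x * y)) (s.alg x ⊗ s.alg y)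
      (s.comul.app ((⟨x⟩, ⟨y⟩) : ξ.Gpd × ξ.Gpd)) (s.isMonHom_comul x y))
    (@Mon.Hom.mk _ _ _ (s.alg 1) (𝟙_ (Mon S)) (s.counit.app ⟨PUnit.unit⟩) s.isMonHom_counit)
    (fun x => @asIso _ _ _ _ (s.anti.app ⟨x⟩) (s.isIso_anti ⟨x⟩))
    s.act
    (fun x y z => by
      have h := ComonObj.comul_assoc (ECat.mk ξ.Gpd F)
      rw [s.comul_eq] at h
      exact ECat.app_of_eq h ((⟨x⟩, ⟨y⟩, ⟨z⟩) : ξ.Gpd × ξ.Gpd × ξ.Gpd))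
    (fun x => by
      have h := ComonObj.counit_comul (ECat.mk ξ.Gpd F)
      rw [s.comul_eq, s.counit_eq] at h
      exact ECat.app_of_eq h ((⟨PUnit.unit⟩, ⟨x⟩) : Discrete PUnit.{w + 1} × ξ.Gpd))
    (fun x => by
      have h := ComonObj.comul_counit (ECat.mk ξ.Gpd F)
      rw [s.comul_eq, s.counit_eq] at h
      exact ECat.app_of_eq h ((⟨x⟩, ⟨PUnit.unit⟩) : ξ.Gpd × Discrete PUnit.{w + 1}))
    (fun x => by
      have h := HopfObj.antipode_left (ECat.mk ξ.Gpd F)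
      rw [s.comul_eq, s.counit_eq, s.anti_eq, s.mul_eq, s.one_eq] at h
      exact ECat.app_of_eq h (⟨x⟩ : ξ.Gpd))
    (fun x => by
      have h := HopfObj.antipode_right (ECat.mk ξ.Gpd F)
      rw [s.comul_eq, s.counit_eq, s.anti_eq, s.mul_eq, s.one_eq] at h
      exact ECat.app_of_eq h (⟨x⟩ : ξ.Gpd))
    (fun x => by
      have hx : x = ξ.bd 1 * x := by rw [map_one, one_mul]
      refine Eq.trans ?_ (CrossedModule.Gpd.eqToHom_eq_map F hx).symm
      exact congrArg F.map (Subtype.ext (CrossedModule.Gpd.eqToHom_val _).symm))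
    (fun x e f => by
      have hx : ξ.bd (f * e) * x = ξ.bd f * (ξ.bd e * x) := by rw [map_mul, mul_assoc]
      refine Eq.trans ?_ (congrArg (F.map (CrossedModule.Gpd.iso x (f * e)).hom ≫ ·)
        (CrossedModule.Gpd.eqToHom_eq_map F hx).symm)
      refine (F.map_comp _ _).symm.trans (Eq.trans (congrArg F.map (Subtype.ext ?_))
        (F.map_comp _ _))
      rw [CrossedModule.Gpd.comp_val, CrossedModule.Gpd.comp_val, CrossedModule.Gpd.eqToHom_val,
        one_mul]
      rfl)
    (fun x y e f => by
      have h := s.comul.naturality (X := ((⟨x⟩, ⟨y⟩) : ξ.Gpd × ξ.Gpd))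
        (Y := ((⟨ξ.bd e * x⟩, ⟨ξ.bd f * y⟩) : ξ.Gpd × ξ.Gpd))
        ((CrossedModule.Gpd.iso x e).hom, (CrossedModule.Gpd.iso y f).hom)
      have hxy : ξ.bd (e * x • f) * (x * y) = ξ.bd e * x * (ξ.bd f * y) :=
        (CrossedModule.mul_aux rfl rfl).symm
      refine h.symm.trans ?_
      refine Eq.trans ?_ (congrArg (fun t => F.map (CrossedModule.Gpd.iso (x * y) (e * x • f)).hom ≫
        t ≫ s.comul.app ((⟨ξ.bd e * x⟩, ⟨ξ.bd f * y⟩) : ξ.Gpd × ξ.Gpd))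
        (CrossedModule.Gpd.eqToHom_eq_map F hxy).symm)
      refine Eq.trans (congrArg (· ≫ s.comul.app ((⟨ξ.bd e * x⟩, ⟨ξ.bd f * y⟩) : ξ.Gpd × ξ.Gpd))
        (Eq.trans (congrArg F.map (Subtype.ext ?_)) (F.map_comp _ _))) (Category.assoc _ _ _)
      change e * x • f = Subtype.val (eqToHom (congrArg CrossedModule.Gpd.of hxy)) * (e * x • f)
      rw [CrossedModule.Gpd.eqToHom_val, one_mul])

/-- The functors agree on objects by definition, but only propositionally on morphisms, because
a Hopf `ξ`-coalgebra only records the action on the morphisms `e : x → ∂(e) x`. -/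
lemma coalg_functor [IsIso (HopfObj.antipode (X := ECat.mk ξ.Gpd F))] : s.coalg.functor = F :=
  CategoryTheory.Functor.ext (fun _ => rfl) (fun x y f => by
    obtain ⟨x⟩ := x
    obtain ⟨y⟩ := y
    obtain ⟨e, h : y = ξ.bd e * x⟩ := f
    subst h
    refine (congrArg Mon.Hom.hom (Category.comp_id (s.act x e).hom)).trans ?_
    exact ((Category.id_comp _).trans
      (Category.comp_id (F.map (CrossedModule.Gpd.iso x e).hom))).symm)

/-- The Hopf algebra of the Hopf `ξ`-coalgebra with components the `F(x)` is the given one. -/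
lemma toHopfAlg_coalg (hS : IsIso (HopfObj.antipode (X := ECat.mk ξ.Gpd F))) :
    HopfPair.toHopfAlg ⟨ξ, s.coalg⟩ = (⟨⟨ECat.mk ξ.Gpd F⟩, hS⟩ : HopfAlg (ECat.{w} S)) := by
  have h : Hopf.mk s.coalg.obj = Hopf.mk (ECat.mk ξ.Gpd F) :=
    ECat.hopf_mk_eq s.coalg_functor s.coalg.hopfObj inferInstance
      (ha₁ := rfl) (hb₁ := s.one_eq) (hab₁ := fun _ => HEq.rfl)
      (ha₂ := rfl) (hb₂ := s.mul_eq) (hab₂ := fun _ => HEq.rfl)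
      (ha₃ := rfl) (hb₃ := s.counit_eq) (hab₃ := fun _ => HEq.rfl)
      (ha₄ := rfl) (hb₄ := s.comul_eq) (hab₄ := fun _ => HEq.rfl)
      (ha₅ := rfl) (hb₅ := s.anti_eq) (hab₅ := fun _ => HEq.rfl)
  have h' : ∀ {X Y : HopfAlg (ECat.{w} S)}, X.obj = Y.obj → X = Y := by
    rintro ⟨X, _⟩ ⟨Y, _⟩ (rfl : X = Y)
    rfl
  exact h' h

end

/-- A Hopf `ξ`-coalgebra is recovered from its Hopf algebra. -/
lemma coalg_eq (A : HopfCoalg S ξ) (s : @GpdHopfData S _ _ _ ξ A.functor A.hopfObj)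
    (hS : IsIso A.hopfObj.antipode) :
    @GpdHopfData.coalg S _ _ _ ξ A.functor A.hopfObj s hS = A := by
  let : HopfObj (ECat.mk ξ.Gpd A.functor) := A.hopfObj
  have h₁ : s.one = A.oneMor.γ := ECat.natTrans_eq_of_eq s.one_eq.symm
  have h₂ : s.mul = A.mulMor.γ := ECat.natTrans_eq_of_eq s.mul_eq.symm
  have h₃ : s.counit = A.counitMor.γ := ECat.natTrans_eq_of_eq s.counit_eq.symm
  have h₄ : s.comul = A.comulMor.γ := ECat.natTrans_eq_of_eq s.comul_eq.symm
  have h₅ : s.anti = A.antiMor.γ := ECat.natTrans_eq_of_eq s.anti_eq.symm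
  -- Once the natural transformations are those of `A`, all data agree by definition, except the
  -- isomorphisms `S_x` and `φ_{x,e}`, which have the same underlying morphisms.
  obtain ⟨one, _, mul, _, counit, _, comul, _, anti, _⟩ := s
  change one = _ at h₁
  change mul = _ at h₂
  change counit = _ at h₃
  change comul = _ at h₄
  change anti = _ at h₅
  subst h₁ h₂ h₃ h₄ h₅
  refine HopfCoalg.ext_of_heq rfl HEq.rfl HEq.rfl (heq_of_eq ?_) (heq_of_eq ?_)
  · funext x
    exact Iso.ext rfl
  · funext x e
    refine Iso.ext (Mon.Hom.ext ?_)
    exact congrArg Mon.Hom.hom (Category.comp_id (A.act x e).hom)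

/-- A Hopf `ξ`-coalgebra is determined by its Hopf algebra. -/
lemma eq_coalg_of_toHopfAlg_eq {F : ξ.Gpd ⥤ S} [i : HopfObj (ECat.mk ξ.Gpd F)]
    (s : GpdHopfData F) (hS : IsIso (HopfObj.antipode (X := ECat.mk ξ.Gpd F)))
    (A : HopfCoalg S ξ)
    (hA : HopfPair.toHopfAlg ⟨ξ, A⟩ = (⟨⟨ECat.mk ξ.Gpd F⟩, hS⟩ : HopfAlg (ECat.{w} S))) :
    A = s.coalg := by
  have h : @Hopf.mk _ _ _ _ (ECat.mk ξ.Gpd A.functor) A.hopfObj =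
    @Hopf.mk _ _ _ _ (ECat.mk ξ.Gpd F) i := congrArg ObjectProperty.FullSubcategory.obj hA
  clear hA
  injection h with h h'
  injection h with _ _ hF
  obtain rfl := hF
  obtain rfl := eq_of_heq h'
  exact (coalg_eq A s hS).symm

end GpdHopfData

end

/-! ### Isomorphisms of pairs -/

namespace CrossedModule

variable {ξ ξ' : CrossedModule.{w}}

/-- The functor between groupoids given by a morphism of crossed modules. -/
def gpdFunctor (ψ : ξ.E →* ξ'.E) (φ : ξ.H →* ξ'.H) (h : ∀ e, ξ'.bd (ψ e) = φ (ξ.bd e)) :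
    ξ.Gpd ⥤ ξ'.Gpd where
  obj x := ⟨φ x.val⟩
  map {x y} e := ⟨ψ e.1, by rw [h, ← map_mul, ← e.2]⟩
  map_id x := Subtype.ext (map_one ψ)
  map_comp e f := Subtype.ext (map_mul ψ f.1 e.1)

/-- The morphism `e : 1 → ∂(e)`. -/
def Gpd.edge (e : ξ.E) : (⟨1⟩ : ξ.Gpd) ⟶ ⟨ξ.bd e⟩ := ⟨e, (mul_one _).symm⟩

/-- The effect of a functor on the elements of `E`, seen as morphisms with source `1`. -/
def onE (Γ : ξ.Gpd ⥤ ξ'.Gpd) (e : ξ.E) : ξ'.E := Subtype.val (Γ.map (Gpd.edge e))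

section

variable {Γ : ξ.Gpd ⥤ ξ'.Gpd}

lemma val_map_eq_of_val_eq {x y x' y' : ξ.Gpd} {e : x ⟶ y} {e' : x' ⟶ y'} (hx : x = x')
    (h : e.1 = e'.1) : Subtype.val (Γ.map e) = Subtype.val (Γ.map e') := by
  subst hx
  obtain ⟨x⟩ := x
  obtain ⟨y⟩ := y
  obtain ⟨y'⟩ := y'
  obtain ⟨e, rfl : y = _⟩ := e
  obtain ⟨e', rfl : y' = _⟩ := e'
  obtain rfl : e = e' := h
  rfl

variable (h : ξ.mulFunctor ⋙ Γ = Γ.prod Γ ⋙ ξ'.mulFunctor)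

/-- The homomorphism on objects given by a functor which respects products. -/
def objHom : ξ.H →* ξ'.H := MonoidHom.mk' (fun x => (Γ.obj ⟨x⟩).val) (fun x y =>
  congrArg Gpd.val (Functor.congr_obj h ((⟨x⟩, ⟨y⟩) : ξ.Gpd × ξ.Gpd)))

lemma val_map_mul
    (h : ξ.mulFunctor ⋙ Γ = Γ.prod Γ ⋙ ξ'.mulFunctor)
    {x y x' y' : ξ.Gpd} (e : x ⟶ y) (f : x' ⟶ y') :
    Subtype.val (Γ.map (ξ.mulFunctor.map (X := (x, x')) (Y := (y, y')) (e, f))) =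
      Subtype.val (Γ.map e) * (Γ.obj x).val • Subtype.val (Γ.map f) :=
  Gpd.val_map_congr h (d := (x, x')) (d' := (y, y')) (e, f)

/-- A functor which respects products is determined by its effect on objects and on the morphisms
with source `1`: every `e : x → y` is the product of `e : 1 → ∂(e)` and the identity of `x`. -/
lemma val_map (h : ξ.mulFunctor ⋙ Γ = Γ.prod Γ ⋙ ξ'.mulFunctor)
    {x y : ξ.Gpd} (e : x ⟶ y) : Subtype.val (Γ.map e) = onE Γ e.1 := by
  have h1 := val_map_mul h (Gpd.edge e.1) (𝟙 x)
  rw [CategoryTheory.Functor.map_id, Gpd.id_val, smul_one, mul_one] at h1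
  refine Eq.trans (val_map_eq_of_val_eq ?_ ?_) h1
  · exact congrArg Gpd.of (one_mul x.val).symm
  · exact (mul_one e.1).symm.trans (congrArg (e.1 * ·) (smul_one (1 : ξ.H)).symm)

lemma onE_smul (x : ξ.H) (e : ξ.E) : onE Γ (x • e) = objHom h x • onE Γ e := by
  have h1 := val_map_mul h (𝟙 (⟨x⟩ : ξ.Gpd)) (Gpd.edge e)
  rw [CategoryTheory.Functor.map_id, Gpd.id_val, one_mul, val_map h] at h1
  refine Eq.trans (congrArg (onE Γ) ?_) h1
  exact (one_mul _).symm

/-- The homomorphism on morphisms with source `1` given by a functor which respects products. -/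
def edgeHom : ξ.E →* ξ'.E := MonoidHom.mk' (onE Γ) (fun e f => by
  have h1 := val_map_mul h (Gpd.edge e) (Gpd.edge f)
  rw [val_map h] at h1
  have h2 : (Γ.obj ⟨1⟩).val = 1 := map_one (objHom h)
  refine Eq.trans (congrArg (onE Γ) ?_) (h1.trans ?_)
  · exact congrArg (e * ·) (one_smul ξ.H f).symm
  · exact congrArg (fun t => onE Γ e * t • onE Γ f) h2 |>.trans
      (congrArg (onE Γ e * ·) (one_smul ξ'.H _)))

lemma bd_onE (e : ξ.E) : ξ'.bd (onE Γ e) = objHom h (ξ.bd e) := by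
  have h1 : (Γ.obj ⟨ξ.bd e⟩).val = ξ'.bd (onE Γ e) * (Γ.obj ⟨1⟩).val := (Γ.map (Gpd.edge e)).2
  have h2 : (Γ.obj ⟨1⟩).val = 1 := map_one (objHom h)
  exact ((h1.trans (congrArg (ξ'.bd (onE Γ e) * ·) h2)).trans (mul_one _)).symm

variable {Γ' : ξ'.Gpd ⥤ ξ.Gpd} (h' : ξ'.mulFunctor ⋙ Γ' = Γ'.prod Γ' ⋙ ξ.mulFunctor)
  (h₁ : Γ ⋙ Γ' = 𝟭 _) (h₂ : Γ' ⋙ Γ = 𝟭 _)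

/-- The isomorphism on objects given by an isomorphism of groupoids which respects products. -/
def objEquiv : ξ.H ≃* ξ'.H where
  toFun := objHom h
  invFun y := (Γ'.obj ⟨y⟩).val
  left_inv x := congrArg Gpd.val (Functor.congr_obj h₁ ⟨x⟩)
  right_inv x := congrArg Gpd.val (Functor.congr_obj h₂ ⟨x⟩)
  map_mul' := map_mul (objHom h)

/-- The isomorphism on morphisms with source `1` given by an isomorphism of groupoids which
respects products. -/
def edgeEquiv : ξ.E ≃* ξ'.E where
  toFun := edgeHom h
  invFun := onE Γ'
  left_inv e := (val_map h' (Γ.map (Gpd.edge e))).symm.trans (Gpd.val_map_congr h₁ (Gpd.edge e))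
  right_inv e := (val_map h (Γ'.map (Gpd.edge e))).symm.trans (Gpd.val_map_congr h₂ (Gpd.edge e))
  map_mul' := map_mul (edgeHom h)

end

end CrossedModule

namespace CategoryTheory

section

variable {B : Type*} [Category B] [MonoidalCategory B]

lemma comp_tensorHom_eq_iff {a b c a' b' c' : B} (f : a ≅ a') (g : b ≅ b') (k : c ≅ c')
    (p : c ⟶ a ⊗ b) (q : c' ⟶ a' ⊗ b') :
    p ≫ (f.hom ⊗ₘ g.hom) = k.hom ≫ q ↔ k.inv ≫ p = q ≫ (f.inv ⊗ₘ g.inv) := by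
  have h : p ≫ (f ⊗ᵢ g).hom = k.hom ≫ q ↔ k.inv ≫ p = q ≫ (f ⊗ᵢ g).inv := by
    rw [← Iso.inv_comp_eq, ← Category.assoc, ← Iso.eq_comp_inv]
  exact h

end

end CategoryTheory

section

variable {S : Type u} [Category.{v} S] [MonoidalCategory S] [SymmetricCategory S]

open scoped MonObj ComonObj

namespace HopfPair

variable {P Q : HopfPair.{w} S}

/-- An isomorphism of pairs gives an isomorphism of Hopf algebras. The morphism is built from the
inverses of the isomorphisms of algebras, since a morphism of `𝓔(S)` contains a functor in the
opposite direction. -/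
lemma Iso.exists_iso (i : P.Iso Q) :
    ∃ e : Q.coalg.obj ≅ P.coalg.obj, IsMonHom e.hom ∧ IsComonHom e.hom := by
  have hbd : ∀ e, P.ξ.bd (i.ψ.symm e) = i.φ.symm (Q.ξ.bd e) := fun e => by
    rw [MulEquiv.eq_symm_apply, ← i.bd_comm, MulEquiv.apply_symm_apply]
  let Γ := CrossedModule.gpdFunctor i.ψ.toMonoidHom i.φ.toMonoidHom i.bd_comm
  let Γ' := CrossedModule.gpdFunctor i.ψ.symm.toMonoidHom i.φ.symm.toMonoidHom hbd
  have h₁ : Γ ⋙ Γ' = 𝟭 _ := CrossedModule.Gpd.functor_ext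
    (fun x => i.φ.symm_apply_apply x.val) (fun f => i.ψ.symm_apply_apply f.1)
  have h₂ : Γ' ⋙ Γ = 𝟭 _ := CrossedModule.Gpd.functor_ext
    (fun x => i.φ.apply_symm_apply x.val) (fun f => i.ψ.apply_symm_apply f.1)
  let θ : Γ ⋙ Q.coalg.functor ≅ P.coalg.functor := NatIso.ofComponents
    (fun x => (Mon.forget S).mapIso (i.f x.val).symm) (fun {x y} f => by
      obtain ⟨x⟩ := x
      obtain ⟨y⟩ := y
      obtain ⟨e, rfl : y = _⟩ := f
      have h := i.act_comm x e
      rw [← Iso.inv_comp_eq, ← Category.assoc, ← Iso.eq_comp_inv] at h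
      refine (congrArg Mon.Hom.hom h).symm.trans (congrArg Mon.Hom.hom (?_ : _ =
        (i.f x).inv ≫ P.coalg.ac e rfl))
      exact congrArg ((i.f x).inv ≫ ·) (Category.comp_id _).symm)
  refine ⟨ECat.isoMk (X := Q.coalg.obj) (Y := P.coalg.obj) Γ Γ' h₂ h₁ θ, ⟨?_, ?_⟩, ⟨?_, ?_⟩⟩
  · exact ECat.hom_ext_same (fun x => IsMonHom.one_hom (i.f x.val).inv.hom)
  · exact ECat.hom_ext_same (fun x => IsMonHom.mul_hom (i.f x.val).inv.hom)
  · refine ECat.hom_ext (CrossedModule.Gpd.functor_ext (fun _ => map_one i.φ)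
      (fun _ => map_one i.ψ)) (fun x => ?_)
    have h := i.cou_comm
    rw [← Iso.inv_comp_eq] at h
    refine (congrArg Mon.Hom.hom h).trans ?_
    rw [Mon.comp_hom', Mon.eqToHom_hom]
    rfl
  · refine ECat.hom_ext (CrossedModule.Gpd.functor_ext (fun p => map_mul i.φ p.1.val p.2.val)
      (fun {p q} f => (map_mul i.ψ _ _).trans (congrArg (i.ψ f.1.1 * ·) (i.smul_comm _ _))))
      (fun x => ?_)
    have h := (comp_tensorHom_eq_iff _ _ _ _ _).1 (i.cop_comm x.1.val x.2.val)
    refine (congrArg Mon.Hom.hom h).trans ?_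
    rw [Mon.comp_hom', Mon.comp_hom', Mon.eqToHom_hom, Category.assoc]
    rfl

/-- An isomorphism of Hopf algebras gives an isomorphism of pairs: its functor part is an
isomorphism of groupoids which respects the product functors, hence comes from an isomorphism of
crossed modules, and the inverses of its components are the isomorphisms of algebras. -/
lemma nonempty_iso (g : Q.coalg.obj ≅ P.coalg.obj) (hm : IsMonHom g.hom)
    (hc : IsComonHom g.hom) : Nonempty (P.Iso Q) := by
  let Γ : P.ξ.Gpd ⥤ Q.ξ.Gpd := ECat.Hom.Γ g.hom
  let Γ' : Q.ξ.Gpd ⥤ P.ξ.Gpd := ECat.Hom.Γ g.inv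
  have hc' : IsComonHom g.inv := inferInstance
  have h : P.ξ.mulFunctor ⋙ Γ = Γ.prod Γ ⋙ Q.ξ.mulFunctor := congrArg ECat.Hom.Γ hc.hom_comul
  have h' : Q.ξ.mulFunctor ⋙ Γ' = Γ'.prod Γ' ⋙ P.ξ.mulFunctor :=
    congrArg ECat.Hom.Γ hc'.hom_comul
  have h₁ : Γ ⋙ Γ' = 𝟭 _ := congrArg ECat.Hom.Γ g.inv_hom_id
  have h₂ : Γ' ⋙ Γ = 𝟭 _ := congrArg ECat.Hom.Γ g.hom_inv_id
  let φ := CrossedModule.objEquiv h h₁ h₂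
  let ψ := CrossedModule.edgeEquiv h h' h₁ h₂
  let θ (x : P.ξ.H) : (Q.coalg.A (φ x)).X ⟶ (P.coalg.A x).X :=
    (ECat.Hom.γ g.hom).app (⟨x⟩ : P.ξ.Gpd)
  have hθ (x : P.ξ.H) : IsIso (θ x) := ECat.isIso_app g.hom (⟨x⟩ : P.ξ.Gpd)
  have hθm (x : P.ξ.H) : IsMonHom (θ x) :=
    ⟨(ECat.app_of_eq hm.one_hom (⟨x⟩ : P.ξ.Gpd)).trans (Category.id_comp _),
      (ECat.app_of_eq hm.mul_hom (⟨x⟩ : P.ξ.Gpd)).trans (Category.id_comp _)⟩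
  let f (x : P.ξ.H) : Q.coalg.A (φ x) ≅ P.coalg.A x :=
    have : IsMonHom (asIso (θ x)).hom := hθm x
    Mon.mkIso' (asIso (θ x))
  refine ⟨⟨ψ, φ, CrossedModule.bd_onE h, CrossedModule.onE_smul h, fun x => (f x).symm,
    fun x y => ?_, ?_, fun x e => ?_⟩⟩
  · refine (comp_tensorHom_eq_iff (f x).symm (f y).symm (f (x * y)).symm _ _).2 ?_
    refine Mon.Hom.ext ?_
    rw [Mon.comp_hom', Mon.comp_hom', Mon.comp_hom', Mon.eqToHom_hom, Category.assoc]
    exact ECat.app_of_eq hc.hom_comul ((⟨x⟩, ⟨y⟩) : P.ξ.Gpd × P.ξ.Gpd)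
  · refine ((f 1).inv_comp_eq.2 ?_).symm
    refine Mon.Hom.ext ?_
    rw [Mon.comp_hom', Mon.comp_hom', Mon.eqToHom_hom]
    exact (ECat.app_of_eq hc.hom_counit (⟨PUnit.unit⟩ : Discrete PUnit)).symm
  · have hn := (ECat.Hom.γ g.hom).naturality (CrossedModule.Gpd.iso x e).hom
    have he : Subtype.val (Γ.map (CrossedModule.Gpd.iso x e).hom) = ψ e :=
      CrossedModule.val_map h _
    have hq := Q.coalg.ac_eq (Γ.map (CrossedModule.Gpd.iso x e).hom).2 he
    have hp : P.coalg.ac e rfl = (P.coalg.act x e).hom := Category.comp_id _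
    refine (Iso.eq_inv_comp (f x)).2 ?_
    rw [← Category.assoc]
    refine (Iso.comp_inv_eq (f (P.ξ.bd e * x))).2 (Mon.Hom.ext ?_)
    rw [← hp]
    exact hn.symm.trans (congrArg (fun t => Mon.Hom.hom t ≫ θ (P.ξ.bd e * x)) hq)

end HopfPair

end

theorem mainTheorem7 (S : Type u) [Category.{v} S] [MonoidalCategory S] [SymmetricCategory S] :
    (∀ P Q : HopfPair.{w} S,
      Nonempty (P.Iso Q) ↔ Nonempty (P.toHopfAlg ≅ Q.toHopfAlg)) ∧
    (∀ X : HopfAlg (ECat.{w} S), ∃ P : HopfPair.{w} S, Nonempty (P.toHopfAlg ≅ X)) ∧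
    (∀ (ξ : CrossedModule.{w}) (F : ξ.Gpd ⥤ S) [HopfObj (ECat.mk ξ.Gpd F)]
      (hS : IsIso (HopfObj.antipode (X := ECat.mk ξ.Gpd F))),
      ECat.Hom.Γ (ComonObj.comul (X := ECat.mk ξ.Gpd F)) = ξ.mulFunctor →
        ∃! A : HopfCoalg S ξ,
          HopfPair.toHopfAlg ⟨ξ, A⟩ = (⟨⟨ECat.mk ξ.Gpd F⟩, hS⟩ : HopfAlg (ECat.{w} S))) := by
  refine ⟨fun P Q => ⟨?_, ?_⟩, fun X => ?_, fun ξ F _ hS h => ?_⟩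
  · rintro ⟨i⟩
    obtain ⟨e⟩ := (HopfAlg.nonempty_iso_iff (X := Q.toHopfAlg) (Y := P.toHopfAlg)).2 i.exists_iso
    exact ⟨e.symm⟩
  · rintro ⟨e⟩
    obtain ⟨g, hm, hc⟩ := HopfAlg.nonempty_iso_iff.1 ⟨e.symm⟩
    exact HopfPair.nonempty_iso g hm hc
  · obtain ⟨⟨X⟩, hX : IsIso (HopfObj.antipode (X := X))⟩ := X
    obtain ⟨ξ, F, e, h⟩ := ECat.exists_iso_gpd X
    have h1 := HopfObj.isMonHom_transport e
    have h2 := HopfObj.isComonHom_transport e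
    have h3 := HopfObj.isIso_antipode_transport e
    let := HopfObj.transport e
    obtain ⟨s⟩ := GpdHopfData.nonempty h
    refine ⟨⟨ξ, s.coalg⟩, ?_⟩
    rw [s.toHopfAlg_coalg h3]
    obtain ⟨i⟩ := (HopfAlg.nonempty_iso_iff (X := ⟨⟨X⟩, hX⟩) (Y := ⟨⟨ECat.mk ξ.Gpd F⟩, h3⟩)).2
      ⟨e, h1, h2⟩
    exact ⟨i.symm⟩
  · obtain ⟨s⟩ := GpdHopfData.nonempty h
    refine ⟨s.coalg, s.toHopfAlg_coalg hS, fun A hA => ?_⟩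
    exact s.eq_coalg_of_toHopfAlg_eq hS A hA
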